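/- **Setting.** Let $\Omega=\{(t_1,t_2,t_3)\in\mathbb R^3:\ t_1+t_2+t_3=0,\ -1\le t_1,t_2,t_3<1\}$ with its area measure $d\mathbf t=dt_1dt_2$ and area $|\Omega|$, and let $L_p=L_p(\Omega)$, $1\le p\le\infty$, be the space of measurable complex-valued functions on $\Omega$ with finite norm $\|f\|_p=\big(\frac1{|\Omega|}\int_\Omega|f|^p\,d\mathbf t\big)^{1/p}$ (essential supremum of $|f|$ for $p=\infty$). For integer triples $\mathbf k=(k_1,k_2,k_3)$ with $k_1+k_2+k_3=0$ put $\phi_{\mathbf k}(\mathbf t)=e^{\frac{2\pi i}{3}(k_1t_1+k_2t_2+k_3t_3)}$, $|\mathbf k|=\max_j|k_j|$, and, for $f\in L_1$, $\widehat f(\mathbf k)=\frac1{|\Omega|}\int_\Omega f\,\overline{\phi_{\mathbf k}}\,d\mathbf t$. For $r\in\mathbb N=\{1,2,\dots\}$ and $\varrho\in[0,1)$ the Taylor–Abel–Poisson mean of $f$ is $$A_{\varrho,r}(f)(\mathbf t)=\sum_{\nu=0}^\infty\lambda_{\nu,r}(\varrho)\sum_{|\mathbf k|=\nu}\widehat f(\mathbf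 k)\phi_{\mathbf k}(\mathbf t),$$ where $\lambda_{\nu,r}(\varrho)=1$ for $\nu<r$ and $\lambda_{\nu,r}(\varrho)=\sum_{j=0}^{r-1}\binom{\nu}{j}(1-\varrho)^j\varrho^{\nu-j}$ for $\nu\ge r$. For an integer $m\ge0$, a function $g\in L_1$ is the radial derivative $f^{[m]}$ of $f\in L_1$ if, for all $\mathbf k$, $\widehat g(\mathbf k)=0$ when $|\mathbf k|<m$ and $\widehat g(\mathbf k)=\frac{|\mathbf k|!}{(|\mathbf k|-m)!}\widehat f(\mathbf k)$ when $|\mathbf k|\ge m$ (so $f^{[0]}=f$). For $\delta>0$ and $n\in\mathbb N$ let $$K_n(\delta,f)_p=\inf\big\{\|f-h\|_p+\delta^n\|h^{[n]}\|_p:\ h^{[n]}\in L_p\big\}.$$ Let $\mathcal Z$ (respectively $\mathcal Z_n$) be the set of continuous strictly increasing functions $\omega$ on $[0,1]$ with $\omega(0)=0$ such that $\int_0^\delta\frac{\omega(t)}{t}\,dt=O(\omega(\delta))$ (respectively $\int_\delta^1\frac{\omega(t)}{t^{n+1}}\,dt=O\big(\frac{\omega(\delta)}{\delta^n}\big)$)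 as $\delta\to0+$; in the first condition the integral is required to converge. **Theorem.** Let $1\le p\le\infty$, $f\in L_p(\Omega)$, $n,r\in\mathbb N$ with $n\le r$, and $\omega\in\mathcal Z\cap\mathcal Z_n$. If $$\|f-A_{\varrho,r}(f)\|_p=O\big((1-\varrho)^{r-n}\omega(1-\varrho)\big),\qquad \varrho\to1-,$$ then the radial derivative $f^{[r-n]}$ exists and belongs to $L_p(\Omega)$, and $$K_n\big(\delta,f^{[r-n]}\big)_p=O(\omega(\delta)),\qquad\delta\to0+.$$ -/

import Mathlib

open MeasureTheory Filter Topology Asymptotics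
open scoped ENNReal Nat

noncomputable section

namespace Hexagon

/-- The parametrisation of the plane `t₁ + t₂ + t₃ = 0` by the coordinates `(t₁, t₂)`. -/
def homog (q : ℝ × ℝ) : Fin 3 → ℝ := ![q.1, q.2, -q.1 - q.2]

/-- The hexagonal domain `Ω` in homogeneous coordinates. -/
def Omega : Set (Fin 3 → ℝ) :=
  {t | t 0 + t 1 + t 2 = 0 ∧ ∀ j, -1 ≤ t j ∧ t j < 1}

/-- The area measure `dt = dt₁ dt₂` on the plane `t₁ + t₂ + t₃ = 0`. -/
def planeMeasure : Measure (Fin 3 → ℝ) := (volume : Measure (ℝ × ℝ)).map homog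

/-- The normalised area measure `dt / |Ω|` on the hexagonal domain. The space `L_p(Ω)` consists of
the functions `f` with `MemLp f p hexMeasure`, and its norm is `eLpNorm f p hexMeasure`. -/
def hexMeasure : Measure (Fin 3 → ℝ) :=
  (planeMeasure Omega)⁻¹ • planeMeasure.restrict Omega

/-- The trigonometric monomial `φ_k(t) = exp ((2πi/3) k·t)`. -/
def phi (k : Fin 3 → ℤ) (t : Fin 3 → ℝ) : ℂ :=
  Complex.exp (2 * Real.pi * Complex.I / 3 * ((∑ j, (k j : ℝ) * t j : ℝ) : ℂ))

/-- The Fourier coefficient `⟨f, φ_k⟩`. -/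
def coeff (f : (Fin 3 → ℝ) → ℂ) (k : Fin 3 → ℤ) : ℂ :=
  ∫ t, f t * starRingEnd ℂ (phi k t) ∂hexMeasure

/-- `|k| = max_j |k_j|`. -/
def size (k : Fin 3 → ℤ) : ℕ := Finset.univ.sup fun j => (k j).natAbs

/-- The integer triples `k` with `k₁ + k₂ + k₃ = 0` and `|k| = ν`. -/
def shell (ν : ℕ) : Finset (Fin 3 → ℤ) :=
  (Fintype.piFinset fun _ => Finset.Icc (-(ν : ℤ)) ν).filter
    fun k => k 0 + k 1 + k 2 = 0 ∧ size k = ν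

theorem mem_shell {ν : ℕ} {k : Fin 3 → ℤ} :
    k ∈ shell ν ↔ k 0 + k 1 + k 2 = 0 ∧ size k = ν := by
  simp only [shell, Finset.mem_filter, Fintype.mem_piFinset, Finset.mem_Icc,
    and_iff_right_iff_imp]
  rintro ⟨-, h⟩ j
  have hj : (k j).natAbs ≤ size k :=
    Finset.le_sup (f := fun j => (k j).natAbs) (Finset.mem_univ j)
  omega

/-- The multipliers `λ_{ν,r}(ϱ)` of the Taylor-Abel-Poisson means. -/
def tapCoeff (r : ℕ) (ϱ : ℝ) (ν : ℕ) : ℝ :=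
  if ν < r then 1
  else ∑ j ∈ Finset.range r, (ν.choose j : ℝ) * (1 - ϱ) ^ j * ϱ ^ (ν - j)

/-- The Taylor-Abel-Poisson mean `A_{ϱ,r}(f)`. -/
def tap (r : ℕ) (ϱ : ℝ) (f : (Fin 3 → ℝ) → ℂ) (t : Fin 3 → ℝ) : ℂ :=
  ∑' ν : ℕ, (tapCoeff r ϱ ν : ℂ) * ∑ k ∈ shell ν, coeff f k * phi k t

/-- `g` is the radial derivative `f^{[n]}` of order `n` of `f` (for `n = 0` this says that `g` has
the Fourier coefficients of `f`, that is, `g = f` almost everywhere). -/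
structure IsRadialDeriv (n : ℕ) (f g : (Fin 3 → ℝ) → ℂ) : Prop where
  integrable_left : Integrable f hexMeasure
  integrable_right : Integrable g hexMeasure
  coeff_eq : ∀ k : Fin 3 → ℤ, k 0 + k 1 + k 2 = 0 →
    coeff g k = if size k < n then 0
      else (((size k)! : ℂ) / ((size k - n)! : ℂ)) * coeff f k

/-- The `K`-functional `K_n(δ, f)_p`, the infimum of `‖f - h‖_p + δ^n ‖h^{[n]}‖_p` over all `h`
whose radial derivative `g = h^{[n]}` exists and belongs to `L_p(Ω)`. -/
def kFunctional (n : ℕ) (p : ℝ≥0∞) (δ : ℝ) (f : (Fin 3 → ℝ) → ℂ) : ℝ≥0∞ :=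
  ⨅ (h : (Fin 3 → ℝ) → ℂ) (g : (Fin 3 → ℝ) → ℂ)
    (_ : IsRadialDeriv n h g ∧ MemLp g p hexMeasure),
    eLpNorm (f - h) p hexMeasure + ENNReal.ofReal (δ ^ n) * eLpNorm g p hexMeasure

/-- Continuous strictly increasing functions on `[0, 1]` vanishing at `0`. -/
structure IsMajorant (ω : ℝ → ℝ) : Prop where
  continuousOn : ContinuousOn ω (Set.Icc 0 1)
  strictMonoOn : StrictMonoOn ω (Set.Icc 0 1)
  map_zero : ω 0 = 0

/-- The class `𝒵`: the integral of `ω(t)/t` over `(0, δ)` converges and is `O(ω(δ))`. -/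
structure ClassZ (ω : ℝ → ℝ) : Prop extends IsMajorant ω where
  integrable : IntervalIntegrable (fun t => ω t / t) volume 0 1
  isBigO : (fun δ : ℝ => ∫ t in (0 : ℝ)..δ, ω t / t) =O[𝓝[>] 0] ω

/-- The class `𝒵_n`: the integral of `ω(t)/t^(n+1)` over `(δ, 1)` is `O(ω(δ)/δ^n)`. -/
structure ClassZn (n : ℕ) (ω : ℝ → ℝ) : Prop extends IsMajorant ω where
  isBigO : (fun δ : ℝ => ∫ t in δ..(1 : ℝ), ω t / t ^ (n + 1)) =O[𝓝[>] 0] fun δ => ω δ / δ ^ n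

end Hexagon

end

namespace Hexagon

/-! Everything rests on a positive kernel. If k₁ + k₂ + k₃ = 0, then |k₁| + |k₂| + |k₃| = 2|k|, so
σ^(2|k|) is a product of three one-dimensional Poisson coefficients. The hexagonal kernel with this
symbol is therefore the average of a product of three Poisson kernels along the diagonal: it is
nonnegative with mass 1, and by Schur's test it acts on every L_p with norm at most 1. The kernel
with symbol |k|σ^(2|k|) is dominated pointwise by the same kernel times 3/(2(1 - σ))
(`norm_radialKernel_deriv_le`). Splitting ϱ^ν into powers of σ and spending one σ^(2ν) on each
linear factor of a falling factorial gives a Bernstein inequality (`isMultiplier_tap`): derivatives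
of orders a and b of the mean with parameter ϱ cost (1 - ϱ)^(-(a+b)).

Let A_N be the mean with ϱ = 1 - 2^(-N), and let m = r - n. Since multipliers commute, A_{N+1} - A_N
= A_{N+1}(1 - A_N) - A_N(1 - A_{N+1}), so consecutive differences see only the approximation errors.
By Bernstein, the derivatives of orders m and b of the difference are O(ω(2^(-N)) 2^(Nb))
(`eLpNorm_dyadic_sub_le`). For b = 0, the condition 𝒵 makes the differences summable: the m-th
derivatives of A_N f converge to f^{[m]} with error O(ω(2^(-N))). For b = n, the condition 𝒵_n
bounds the further n-th derivatives by O(ω(2^(-N)) 2^(Nn)). Taking h to be the m-th derivative of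
A_N f with 2^(-N) comparable to δ bounds the K-functional. -/

/-! ### The normalised measure on the hexagon -/

theorem measurable_homog : Measurable homog := by
  refine measurable_pi_iff.2 fun j => ?_
  fin_cases j <;> simp [homog] <;> fun_prop

theorem measurableSet_Omega : MeasurableSet Omega := by
  unfold Omega
  refine MeasurableSet.inter ?_ ?_
  · exact measurableSet_eq_fun (by fun_prop) (by fun_prop)
  · change MeasurableSet {t : Fin 3 → ℝ | ∀ j, -1 ≤ t j ∧ t j < 1}
    simp only [Set.ofPred_forall]
    refine MeasurableSet.iInter fun j => ?_
    exact (measurableSet_le measurable_const (measurable_pi_apply j)).inter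
      (measurableSet_lt (measurable_pi_apply j) measurable_const)

theorem mem_preimage_Omega {q : ℝ × ℝ} : q ∈ homog ⁻¹' Omega ↔
    (-1 ≤ q.1 ∧ q.1 < 1) ∧ (-1 ≤ q.2 ∧ q.2 < 1) ∧ (-1 ≤ -q.1 - q.2 ∧ -q.1 - q.2 < 1) := by
  simp [Omega, homog, Fin.forall_fin_succ]

theorem planeMeasure_Omega : planeMeasure Omega = volume (homog ⁻¹' Omega) :=
  Measure.map_apply measurable_homog measurableSet_Omega

theorem planeMeasure_Omega_ne_zero : planeMeasure Omega ≠ 0 := by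
  rw [planeMeasure_Omega]
  have hsub : Set.Ioo (0 : ℝ) 2⁻¹ ×ˢ Set.Ioo (0 : ℝ) 2⁻¹ ⊆ homog ⁻¹' Omega := by
    rintro ⟨x, y⟩ ⟨⟨h1, h2⟩, h3, h4⟩
    rw [mem_preimage_Omega]
    norm_num at *
    refine ⟨⟨?_, ?_⟩, ⟨?_, ?_⟩, ?_, ?_⟩ <;> linarith
  refine fun h => absurd (measure_mono_null hsub h) ?_
  rw [Measure.volume_eq_prod, Measure.prod_prod]
  simp

theorem planeMeasure_Omega_ne_top : planeMeasure Omega ≠ ∞ := by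
  rw [planeMeasure_Omega]
  have hsub : homog ⁻¹' Omega ⊆ Set.Icc (-1 : ℝ) 1 ×ˢ Set.Icc (-1 : ℝ) 1 := by
    rintro ⟨x, y⟩ h
    rw [mem_preimage_Omega] at h
    exact ⟨⟨h.1.1, h.1.2.le⟩, h.2.1.1, h.2.1.2.le⟩
  refine ((measure_mono hsub).trans_lt ?_).ne
  rw [Measure.volume_eq_prod, Measure.prod_prod]
  simp [ENNReal.mul_lt_top_iff]

instance : IsProbabilityMeasure hexMeasure := by
  refine ⟨?_⟩
  simp [hexMeasure, ENNReal.inv_mul_cancel planeMeasure_Omega_ne_zero planeMeasure_Omega_ne_top]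

/-! ### Orthonormality of the monomials -/

/-- Cutting the hexagon along t₁ = 0 and moving the left half by (1, 1) places it on top of the
right half. Together they fill the rectangle (0, 1) × [-1, 2), where Fubini applies; the null lines
t₁ = 0 and t₁ = -1 are discarded. -/
theorem ae_homog_preimage_Omega : (homog ⁻¹' Omega : Set (ℝ × ℝ)) =ᵐ[volume]
    ({q | q.1 ∈ Set.Ioo (0 : ℝ) 1 ∧ -1 ≤ q.2 ∧ q.2 ≤ 1 - q.1} ∪
      (fun q : ℝ × ℝ => q + (1, 1)) ⁻¹'
        {q | q.1 ∈ Set.Ioo (0 : ℝ) 1 ∧ 1 - q.1 < q.2 ∧ q.2 < 2} : Set (ℝ × ℝ)) := by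
  have hne (a : ℝ) : ∀ᵐ q : ℝ × ℝ, q.1 ≠ a := by
    have : volume (({a} : Set ℝ) ×ˢ (Set.univ : Set ℝ)) = 0 := by
      rw [Measure.volume_eq_prod, Measure.prod_prod]; simp
    refine measure_mono_null ?_ this
    rintro ⟨x, y⟩ h
    simpa using h
  filter_upwards [hne 0, hne (-1)] with q h0 h1
  refine propext ((mem_preimage_Omega (q := q)).trans ?_)
  change _ ↔ ((_ ∧ _) ∧ _) ∨ ((_ ∧ _) ∧ _)
  simp only [Prod.fst_add, Prod.snd_add]
  rcases lt_or_gt_of_ne h0 with h | h <;> rcases lt_or_gt_of_ne h1 with h' | h'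
  all_goals constructor
  all_goals first
    | (rintro ⟨⟨h1, h2⟩, ⟨h3, h4⟩, h5, h6⟩
       first
        | (exfalso; linarith)
        | (left; refine ⟨⟨?_, ?_⟩, ?_, ?_⟩ <;> linarith)
        | (right; refine ⟨⟨?_, ?_⟩, ?_, ?_⟩ <;> linarith))
    | (rintro (⟨⟨h1, h2⟩, h3, h4⟩ | ⟨⟨h1, h2⟩, h3, h4⟩) <;>
        first
        | (exfalso; linarith)
        | (refine ⟨⟨?_, ?_⟩, ⟨?_, ?_⟩, ?_, ?_⟩ <;> linarith))

theorem setIntegral_preimage_Omega {F : ℝ × ℝ → ℂ} (hF : Continuous F)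
    (hper : ∀ q, F (q + (1, 1)) = F q) :
    ∫ q in homog ⁻¹' Omega, F q = ∫ q in Set.Ioo (0 : ℝ) 1 ×ˢ Set.Ico (-1 : ℝ) 2, F q := by
  have hint {s : Set (ℝ × ℝ)} (hs : s ⊆ Set.Icc (-1 : ℝ) 2 ×ˢ Set.Icc (-1 : ℝ) 2) :
      IntegrableOn F s :=
    (hF.continuousOn.integrableOn_compact (isCompact_Icc.prod isCompact_Icc)).mono_set hs
  rw [setIntegral_congr_set ae_homog_preimage_Omega]
  have hm2 : MeasurableSet {q : ℝ × ℝ | q.1 ∈ Set.Ioo (0 : ℝ) 1 ∧ 1 - q.1 < q.2 ∧ q.2 < 2} :=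
    (measurable_fst measurableSet_Ioo).inter
      ((measurableSet_lt (measurable_const.sub measurable_fst) measurable_snd).inter
        (measurableSet_lt measurable_snd measurable_const))
  have hrect : Set.Ioo (0 : ℝ) 1 ×ˢ Set.Ico (-1 : ℝ) 2 =
      {q | q.1 ∈ Set.Ioo (0 : ℝ) 1 ∧ -1 ≤ q.2 ∧ q.2 ≤ 1 - q.1} ∪
        {q | q.1 ∈ Set.Ioo (0 : ℝ) 1 ∧ 1 - q.1 < q.2 ∧ q.2 < 2} := by
    ext ⟨x, y⟩
    simp only [Set.mem_prod, Set.mem_union, Set.mem_ofPred_eq, Set.mem_Ico, Set.mem_Ioo]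
    constructor
    · rintro ⟨h1, h2, h3⟩
      rcases le_or_gt y (1 - x) with h | h
      · exact Or.inl ⟨h1, h2, h⟩
      · exact Or.inr ⟨h1, h, h3⟩
    · rintro (⟨h1, h2, h3⟩ | ⟨h1, h2, h3⟩)
      · exact ⟨h1, h2, by linarith⟩
      · exact ⟨h1, by linarith, h3⟩
  rw [hrect, setIntegral_union, setIntegral_union _ hm2]
  · congr 1
    have := (measurePreserving_add_right (volume : Measure (ℝ × ℝ)) (1, 1)).setIntegral_preimage_emb
      (measurableEmbedding_addRight _) F
      {q | q.1 ∈ Set.Ioo (0 : ℝ) 1 ∧ 1 - q.1 < q.2 ∧ q.2 < 2}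
    simpa only [hper] using this
  · refine hint ?_
    rintro ⟨x, y⟩ ⟨⟨h1, h2⟩, h3, h4⟩
    exact ⟨⟨by linarith, by linarith⟩, by linarith, by linarith⟩
  · refine hint ?_
    rintro ⟨x, y⟩ ⟨⟨h1, h2⟩, h3, h4⟩
    exact ⟨⟨by linarith, by linarith⟩, by linarith, by linarith⟩
  · rw [Set.disjoint_left]
    rintro ⟨x, y⟩ ⟨⟨h1, h2⟩, h3, h4⟩ ⟨⟨h1', h2'⟩, h3', h4'⟩
    linarith
  · rw [Set.disjoint_left]
    rintro ⟨x, y⟩ ⟨⟨h1, h2⟩, h3, h4⟩ ⟨⟨h1', h2'⟩, h3', h4'⟩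
    simp at *
    linarith
  · exact hm2.preimage (by fun_prop)
  · refine hint ?_
    rintro ⟨x, y⟩ ⟨⟨h1, h2⟩, h3, h4⟩
    exact ⟨⟨by linarith, by linarith⟩, by linarith, by linarith⟩
  · refine hint ?_
    rintro ⟨x, y⟩ ⟨⟨h1, h2⟩, h3, h4⟩
    simp at h1 h2 h3 h4
    exact ⟨⟨by linarith, by linarith⟩, by linarith, by linarith⟩

theorem phi_eq_exp_mul_exp (k : Fin 3 → ℤ) (q : ℝ × ℝ) : phi k (homog q) =
    Complex.exp (2 * Real.pi * Complex.I / 3 * (k 0 - k 2) * q.1) *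
      Complex.exp (2 * Real.pi * Complex.I / 3 * (k 1 - k 2) * q.2) := by
  rw [← Complex.exp_add, phi]
  congr 1
  simp [Fin.sum_univ_three, homog]
  ring

theorem continuous_phi (k : Fin 3 → ℤ) : Continuous (phi k) := by
  unfold phi; fun_prop

theorem integral_exp_interval {a b : ℝ} {c : ℂ} (hc : c ≠ 0)
    (h : Complex.exp (c * (b - a)) = 1) : ∫ x in a..b, Complex.exp (c * x) = 0 := by
  rw [integral_exp_mul_complex hc]
  have : Complex.exp (c * b) = Complex.exp (c * a) := by
    rw [show c * (b : ℂ) = c * (b - a) + c * a by ring, Complex.exp_add, h, one_mul]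
  rw [this, sub_self, zero_div]

theorem integral_phi {k : Fin 3 → ℤ} (hk : k 0 + k 1 + k 2 = 0) :
    ∫ t, phi k t ∂hexMeasure = if k = 0 then 1 else 0 := by
  split_ifs with h0
  · subst h0
    simp [phi]
  rw [hexMeasure, integral_smul_measure]
  have : ∫ t in Omega, phi k t ∂planeMeasure = 0 := by
    rw [planeMeasure, setIntegral_map measurableSet_Omega
      (continuous_phi k).aestronglyMeasurable measurable_homog.aemeasurable]
    have hk' : (k 0 : ℂ) + k 1 + k 2 = 0 := by exact_mod_cast hk
    rw [setIntegral_preimage_Omega]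
    · simp only [phi_eq_exp_mul_exp]
      rw [Measure.volume_eq_prod, setIntegral_prod_mul
        (fun x : ℝ => Complex.exp (2 * Real.pi * Complex.I / 3 * (k 0 - k 2) * x))
        (fun x : ℝ => Complex.exp (2 * Real.pi * Complex.I / 3 * (k 1 - k 2) * x))]
      rw [← integral_Ioc_eq_integral_Ioo, integral_Ico_eq_integral_Ioo,
        ← integral_Ioc_eq_integral_Ioo, ← intervalIntegral.integral_of_le (by norm_num),
        ← intervalIntegral.integral_of_le (by norm_num)]
      -- If k₂ ≠ k₃, the t₂-integral runs over an interval of length 3, a whole number of periods.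
      -- If k₂ = k₃, then k₁ - k₃ = -3k₃, and the t₁-integral over length 1 vanishes instead.
      by_cases h12 : k 1 = k 2
      · have h2 : k 2 ≠ 0 := by
          rintro h
          apply h0
          funext j
          fin_cases j <;> simp <;> omega
        rw [integral_exp_interval, zero_mul]
        · have : (k 0 : ℂ) - k 2 ≠ 0 := by
            have : k 0 - k 2 ≠ 0 := by omega
            exact_mod_cast this
          simp [this, Real.pi_ne_zero]
        · rw [Complex.exp_eq_one_iff]
          refine ⟨- k 2, ?_⟩
          rw [h12] at hk'
          rw [show (k 0 : ℂ) = - k 2 - k 2 by linear_combination hk']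
          push_cast
          ring
      · rw [mul_comm, integral_exp_interval, zero_mul]
        · have : (k 1 : ℂ) - k 2 ≠ 0 := by
            have : k 1 - k 2 ≠ 0 := by omega
            exact_mod_cast this
          simp [this, Real.pi_ne_zero]
        · rw [Complex.exp_eq_one_iff]
          refine ⟨k 1 - k 2, ?_⟩
          push_cast
          ring
    · have hc : Continuous homog := by
        refine continuous_pi fun j => ?_
        fin_cases j <;> simp [homog] <;> fun_prop
      exact (continuous_phi k).comp hc
    · intro q
      rw [phi_eq_exp_mul_exp, phi_eq_exp_mul_exp, ← Complex.exp_add, ← Complex.exp_add,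
        Complex.exp_eq_exp_iff_exists_int]
      -- The shift changes k·t by k₁ + k₂ - 2k₃ = -3k₃.
      refine ⟨- k 2, ?_⟩
      rw [show (k 0 : ℂ) = - k 1 - k 2 by linear_combination hk']
      simp
      ring
  rw [this, smul_zero]

theorem phi_add (k : Fin 3 → ℤ) (s t : Fin 3 → ℝ) : phi k (s + t) = phi k s * phi k t := by
  rw [phi, phi, phi, ← Complex.exp_add]
  congr 1
  rw [← mul_add]
  push_cast
  simp [Fin.sum_univ_three]
  ring

theorem conj_phi (k : Fin 3 → ℤ) (t : Fin 3 → ℝ) : starRingEnd ℂ (phi k t) = phi (-k) t := by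
  rw [phi, phi, ← Complex.exp_conj]
  congr 1
  simp [Fin.sum_univ_three, Complex.conj_ofNat]
  ring

theorem phi_neg_right (k : Fin 3 → ℤ) (t : Fin 3 → ℝ) : phi k (-t) = starRingEnd ℂ (phi k t) := by
  rw [conj_phi, phi, phi]
  congr 1
  simp [Fin.sum_univ_three]

theorem phi_add_left (k l : Fin 3 → ℤ) (t : Fin 3 → ℝ) : phi (k + l) t = phi k t * phi l t := by
  rw [phi, phi, phi, ← Complex.exp_add]
  congr 1
  simp [Fin.sum_univ_three]
  ring

theorem norm_phi (k : Fin 3 → ℤ) (t : Fin 3 → ℝ) : ‖phi k t‖ = 1 := by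
  rw [phi, show (2 * Real.pi * Complex.I / 3 * ((∑ j, (k j : ℝ) * t j : ℝ) : ℂ)) =
    ((2 * Real.pi / 3 * (∑ j, (k j : ℝ) * t j) : ℝ) : ℂ) * Complex.I by push_cast; ring]
  exact Complex.norm_exp_ofReal_mul_I _

theorem coeff_phi {k l : Fin 3 → ℤ} (hk : k 0 + k 1 + k 2 = 0) (hl : l 0 + l 1 + l 2 = 0) :
    coeff (phi k) l = if k = l then 1 else 0 := by
  rw [coeff]
  simp only [conj_phi, ← phi_add_left]
  rw [integral_phi (by simp; omega)]
  simp [add_neg_eq_zero]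

/-! ### Radial multipliers with absolutely summable symbol -/

/-- The radial Fourier multiplier operator with symbol `m (|k|)`. -/
noncomputable def radialMul (m : ℕ → ℂ) (f : (Fin 3 → ℝ) → ℂ) (t : Fin 3 → ℝ) : ℂ :=
  ∑' ν : ℕ, m ν * ∑ k ∈ shell ν, coeff f k * phi k t

/-- Absolute summability of the multiplier `m (|k|)` over the lattice. -/
def ShellSummable (m : ℕ → ℂ) : Prop := Summable fun ν => ‖m ν‖ * (shell ν).card

theorem norm_coeff_le (f : (Fin 3 → ℝ) → ℂ) (k : Fin 3 → ℤ) :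
    ‖coeff f k‖ ≤ ∫ t, ‖f t‖ ∂hexMeasure := by
  refine (norm_integral_le_integral_norm _).trans (le_of_eq ?_)
  simp [norm_phi]

theorem norm_shell_term_le (m : ℕ → ℂ) {c : (Fin 3 → ℤ) → ℂ} {B : ℝ} (hc : ∀ k, ‖c k‖ ≤ B)
    (ν : ℕ) (t : Fin 3 → ℝ) :
    ‖m ν * ∑ k ∈ shell ν, c k * phi k t‖ ≤ ‖m ν‖ * (shell ν).card * B := by
  rw [norm_mul, mul_assoc]
  gcongr
  refine (norm_sum_le_of_le (shell ν) (f := fun k => c k * phi k t) (fun k _ => ?_)).trans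
    (le_of_eq (Finset.sum_const B) |>.trans (le_of_eq (nsmul_eq_mul _ _)))
  rw [norm_mul, norm_phi, mul_one]
  exact hc k

theorem card_shell_pos (ν : ℕ) : 1 ≤ (shell ν).card := by
  refine Finset.card_pos.2 ⟨![ν, -ν, 0], ?_⟩
  rw [mem_shell]
  refine ⟨by simp, ?_⟩
  apply le_antisymm
  · refine Finset.sup_le fun j _ => ?_
    fin_cases j <;> simp
  · exact (Finset.le_sup (f := fun j => ((![ν, -ν, 0] : Fin 3 → ℤ) j).natAbs)
      (Finset.mem_univ 0)).trans' (by simp)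

namespace ShellSummable

variable {m m' : ℕ → ℂ}

theorem bounded (h : ShellSummable m) : ∃ B, ∀ ν, ‖m ν‖ ≤ B := by
  refine ⟨∑' ν, ‖m ν‖ * (shell ν).card, fun ν => ?_⟩
  refine le_trans ?_ (h.le_tsum ν fun _ _ => by positivity)
  exact le_mul_of_one_le_right (norm_nonneg _) (by exact_mod_cast card_shell_pos ν)

theorem of_le (h : ShellSummable m) {B : ℝ} (hle : ∀ ν, ‖m' ν‖ ≤ B * ‖m ν‖) :
    ShellSummable m' := by
  refine Summable.of_nonneg_of_le (fun _ => by positivity) (fun ν => ?_) (h.mul_left B)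
  rw [← mul_assoc]
  gcongr
  exact hle ν

theorem mul (h : ShellSummable m) (h' : ShellSummable m') :
    ShellSummable fun ν => m ν * m' ν := by
  obtain ⟨B, hB⟩ := h.bounded
  refine h'.of_le (B := B) fun ν => ?_
  rw [norm_mul]
  gcongr
  exact hB ν

theorem const_mul (h : ShellSummable m) (c : ℂ) : ShellSummable fun ν => c * m ν :=
  h.of_le (B := ‖c‖) fun ν => by rw [norm_mul]

theorem add (h : ShellSummable m) (h' : ShellSummable m') :
    ShellSummable fun ν => m ν + m' ν := by
  refine Summable.of_nonneg_of_le (fun _ => by positivity) (fun ν => ?_) (Summable.add h h')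
  rw [← add_mul]
  gcongr
  exact norm_add_le _ _

theorem summable_terms (h : ShellSummable m) (f : (Fin 3 → ℝ) → ℂ) (t : Fin 3 → ℝ) :
    Summable fun ν => m ν * ∑ k ∈ shell ν, coeff f k * phi k t :=
  Summable.of_norm_bounded (h.mul_right _) fun ν => norm_shell_term_le m (norm_coeff_le f) ν t

theorem norm_radialMul_le (h : ShellSummable m) (f : (Fin 3 → ℝ) → ℂ) (t : Fin 3 → ℝ) :
    ‖radialMul m f t‖ ≤ ∑' ν, ‖m ν‖ * (shell ν).card * ∫ t, ‖f t‖ ∂hexMeasure :=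
  tsum_of_norm_bounded (h.mul_right _).hasSum fun ν => norm_shell_term_le m (norm_coeff_le f) ν t

theorem continuous_radialMul (h : ShellSummable m) (f : (Fin 3 → ℝ) → ℂ) :
    Continuous (radialMul m f) := by
  refine continuous_tsum (fun ν => ?_) (h.mul_right _)
    fun ν t => norm_shell_term_le m (norm_coeff_le f) ν t
  have := continuous_phi
  fun_prop

theorem memLp_radialMul (h : ShellSummable m) (f : (Fin 3 → ℝ) → ℂ) (p : ℝ≥0∞) :
    MemLp (radialMul m f) p hexMeasure :=
  MemLp.of_bound (h.continuous_radialMul f).aestronglyMeasurable _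
    (Eventually.of_forall (h.norm_radialMul_le f))

theorem integrable_radialMul (h : ShellSummable m) (f : (Fin 3 → ℝ) → ℂ) :
    Integrable (radialMul m f) hexMeasure :=
  memLp_one_iff_integrable.1 (h.memLp_radialMul f 1)

end ShellSummable

theorem coeff_sum_phi (c : (Fin 3 → ℤ) → ℂ) (a : ℂ) (ν : ℕ) {l : Fin 3 → ℤ}
    (hl : l 0 + l 1 + l 2 = 0) :
    coeff (fun t => a * ∑ k ∈ shell ν, c k * phi k t) l = if ν = size l then a * c l else 0 := by
  have hint (k : Fin 3 → ℤ) : Integrable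
      (fun t => phi k t * starRingEnd ℂ (phi l t)) hexMeasure := by
    refine Integrable.of_bound (C := 1) ?_ (Eventually.of_forall fun t => ?_)
    · simp only [conj_phi]
      exact ((continuous_phi k).mul (continuous_phi (-l))).aestronglyMeasurable
    · simp [norm_phi]
  simp only [coeff, mul_assoc, Finset.sum_mul, Finset.mul_sum]
  rw [integral_finsetSum _ fun k _ => ((hint k).const_mul _).const_mul _]
  have (k) (hk : k ∈ shell ν) : ∫ t, a * (c k * (phi k t * starRingEnd ℂ (phi l t))) ∂hexMeasure =
      if l = k then a * c k else 0 := by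
    rw [integral_const_mul, integral_const_mul]
    have := coeff_phi (mem_shell.1 hk).1 hl
    rw [coeff] at this
    rw [this]
    simp only [eq_comm (a := k)]
    split_ifs <;> ring
  rw [Finset.sum_congr rfl this, Finset.sum_ite_eq]
  simp [mem_shell, hl, eq_comm]

theorem coeff_radialMul {m : ℕ → ℂ} (h : ShellSummable m) (f : (Fin 3 → ℝ) → ℂ) {l : Fin 3 → ℤ}
    (hl : l 0 + l 1 + l 2 = 0) : coeff (radialMul m f) l = m (size l) * coeff f l := by
  have key := hasSum_integral_of_summable_integral_norm (μ := hexMeasure)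
    (F := fun ν t => (m ν * ∑ k ∈ shell ν, coeff f k * phi k t) * starRingEnd ℂ (phi l t))
    (fun ν => by
      refine Integrable.of_bound (C := ‖m ν‖ * (shell ν).card * ∫ t, ‖f t‖ ∂hexMeasure) ?_
        (Eventually.of_forall fun t => ?_)
      · simp only [conj_phi]
        have := continuous_phi
        exact Continuous.aestronglyMeasurable (by fun_prop)
      · rw [norm_mul, RCLike.norm_conj, norm_phi, mul_one]
        exact norm_shell_term_le m (norm_coeff_le f) ν t)
    (by
      refine Summable.of_nonneg_of_le (fun ν => integral_nonneg fun _ => norm_nonneg _)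
        (fun ν => ?_) (h.mul_right (∫ t, ‖f t‖ ∂hexMeasure))
      refine (integral_mono_of_nonneg (g := fun _ => ‖m ν‖ * (shell ν).card *
        ∫ t, ‖f t‖ ∂hexMeasure) (Eventually.of_forall fun _ => norm_nonneg _)
        (integrable_const _) (Eventually.of_forall fun t => ?_)).trans (by simp)
      simp only
      rw [norm_mul, RCLike.norm_conj, norm_phi, mul_one]
      exact norm_shell_term_le m (norm_coeff_le f) ν t)
  have hval (ν : ℕ) : ∫ t, (m ν * ∑ k ∈ shell ν, coeff f k * phi k t) *
      starRingEnd ℂ (phi l t) ∂hexMeasure = if ν = size l then m ν * coeff f l else 0 :=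
    coeff_sum_phi (coeff f) (m ν) ν hl
  simp only [hval, tsum_mul_right] at key
  rw [coeff]
  simp only [radialMul]
  rw [← key.tsum_eq, tsum_ite_eq]

/-- The identity holds term by term in the defining series, so only the inner symbol has to be
summable. -/
theorem radialMul_radialMul {m : ℕ → ℂ} (h : ShellSummable m) (m' : ℕ → ℂ)
    (f : (Fin 3 → ℝ) → ℂ) :
    radialMul m' (radialMul m f) = radialMul (fun ν => m' ν * m ν) f := by
  funext t
  refine tsum_congr fun ν => ?_
  rw [mul_assoc, Finset.mul_sum _ _ (m ν)]
  congr 1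
  refine Finset.sum_congr rfl fun k hk => ?_
  obtain ⟨h0, h1⟩ := mem_shell.1 hk
  rw [coeff_radialMul h f h0, h1, mul_assoc]

theorem coeff_sub {f g : (Fin 3 → ℝ) → ℂ} (hf : Integrable f hexMeasure)
    (hg : Integrable g hexMeasure) (k : Fin 3 → ℤ) : coeff (f - g) k = coeff f k - coeff g k := by
  have hint {f : (Fin 3 → ℝ) → ℂ} (hf : Integrable f hexMeasure) :
      Integrable (fun t => f t * starRingEnd ℂ (phi k t)) hexMeasure := by
    refine hf.mul_bdd (c := 1) ?_ (Eventually.of_forall fun t => ?_)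
    · simp only [conj_phi]
      exact (continuous_phi _).aestronglyMeasurable
    · simp [norm_phi]
  simp only [coeff, Pi.sub_apply, sub_mul]
  exact integral_sub (hint hf) (hint hg)

theorem radialMul_sub {m : ℕ → ℂ} (h : ShellSummable m) {f g : (Fin 3 → ℝ) → ℂ}
    (hf : Integrable f hexMeasure) (hg : Integrable g hexMeasure) :
    radialMul m (f - g) = radialMul m f - radialMul m g := by
  funext t
  rw [Pi.sub_apply, radialMul, radialMul, radialMul,
    ← (h.summable_terms f t).tsum_sub (h.summable_terms g t)]
  refine tsum_congr fun ν => ?_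
  rw [← mul_sub, ← Finset.sum_sub_distrib]
  simp only [coeff_sub hf hg, sub_mul]

theorem radialMul_add_left {m m' : ℕ → ℂ} (h : ShellSummable m) (h' : ShellSummable m')
    (f : (Fin 3 → ℝ) → ℂ) :
    radialMul (fun ν => m ν + m' ν) f = radialMul m f + radialMul m' f := by
  funext t
  rw [Pi.add_apply, radialMul, radialMul, radialMul,
    ← (h.summable_terms f t).tsum_add (h'.summable_terms f t)]
  simp only [add_mul]

theorem radialMul_const_mul_left (c : ℂ) (m : ℕ → ℂ) (f : (Fin 3 → ℝ) → ℂ) :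
    radialMul (fun ν => c * m ν) f = c • radialMul m f := by
  funext t
  simp only [radialMul, mul_assoc, tsum_mul_left, Pi.smul_apply, smul_eq_mul]

/-! ### Convolution kernels of radial multipliers -/

/-- The convolution kernel of `radialMul m`. -/
noncomputable def radialKernel (m : ℕ → ℂ) (t : Fin 3 → ℝ) : ℂ :=
  ∑' ν : ℕ, m ν * ∑ k ∈ shell ν, phi k t

theorem norm_shell_phi_le (m : ℕ → ℂ) (ν : ℕ) (t : Fin 3 → ℝ) :
    ‖m ν * ∑ k ∈ shell ν, phi k t‖ ≤ ‖m ν‖ * (shell ν).card := by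
  simpa using norm_shell_term_le m (c := fun _ => 1) (B := 1) (by simp) ν t

theorem ShellSummable.continuous_radialKernel {m : ℕ → ℂ} (h : ShellSummable m) :
    Continuous (radialKernel m) := by
  refine continuous_tsum (fun ν => ?_) h (norm_shell_phi_le m)
  have := continuous_phi
  fun_prop

theorem radialMul_eq_integral {m : ℕ → ℂ} (h : ShellSummable m) {f : (Fin 3 → ℝ) → ℂ}
    (hf : Integrable f hexMeasure) (t : Fin 3 → ℝ) :
    radialMul m f t = ∫ s, f s * radialKernel m (t - s) ∂hexMeasure := by
  have hb (ν : ℕ) (s : Fin 3 → ℝ) : ‖f s * (m ν * ∑ k ∈ shell ν, phi k (t - s))‖ ≤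
      ‖f s‖ * (‖m ν‖ * (shell ν).card) := by
    rw [norm_mul]
    gcongr
    exact norm_shell_phi_le m ν _
  have hcont (ν : ℕ) : Continuous fun s => m ν * ∑ k ∈ shell ν, phi k (t - s) := by
    have := continuous_phi
    fun_prop
  have key := hasSum_integral_of_summable_integral_norm (μ := hexMeasure)
    (F := fun ν s => f s * (m ν * ∑ k ∈ shell ν, phi k (t - s)))
    (fun ν => hf.mul_bdd (c := ‖m ν‖ * (shell ν).card) (hcont ν).aestronglyMeasurable
      (Eventually.of_forall fun s => norm_shell_phi_le m ν _))
    (by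
      refine Summable.of_nonneg_of_le (fun ν => integral_nonneg fun _ => norm_nonneg _)
        (fun ν => ?_) (h.mul_left (∫ t, ‖f t‖ ∂hexMeasure))
      refine (integral_mono_of_nonneg (Eventually.of_forall fun _ => norm_nonneg _)
        (hf.norm.mul_const _) (Eventually.of_forall fun s => hb ν s)).trans (le_of_eq ?_)
      rw [integral_mul_const])
  simp only [tsum_mul_left] at key
  rw [radialMul, show (fun s => f s * radialKernel m (t - s)) = fun s => f s *
    ∑' ν : ℕ, m ν * ∑ k ∈ shell ν, phi k (t - s) from rfl, ← key.tsum_eq]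
  refine tsum_congr fun ν => ?_
  have hint (k : Fin 3 → ℤ) : Integrable (fun s => f s * starRingEnd ℂ (phi k s)) hexMeasure := by
    refine hf.mul_bdd (c := 1) ?_ (Eventually.of_forall fun t => ?_)
    · simp only [conj_phi]
      exact (continuous_phi _).aestronglyMeasurable
    · simp [norm_phi]
  have : ∀ s, f s * (m ν * ∑ k ∈ shell ν, phi k (t - s)) =
      m ν * ∑ k ∈ shell ν, f s * starRingEnd ℂ (phi k s) * phi k t := by
    intro s
    rw [mul_left_comm, Finset.mul_sum]
    congr 1
    refine Finset.sum_congr rfl fun k _ => ?_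
    rw [sub_eq_add_neg, phi_add, phi_neg_right]
    ring
  simp only [this]
  rw [integral_const_mul, integral_finsetSum _ fun k _ => (hint k).mul_const _]
  simp only [integral_mul_const, coeff]

/-- Apply the operator to the constant 1, whose only nonzero coefficient is at k = 0. This gives the
mass of every translate of the kernel over the hexagon without invoking periodicity. -/
theorem integral_radialKernel_sub {m : ℕ → ℂ} (h : ShellSummable m) (t : Fin 3 → ℝ) :
    ∫ s, radialKernel m (t - s) ∂hexMeasure = m 0 := by
  have h1 := radialMul_eq_integral h (f := fun _ => 1) (integrable_const _) t
  simp only [one_mul] at h1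
  rw [← h1, radialMul]
  have hc (k : Fin 3 → ℤ) (hk : k 0 + k 1 + k 2 = 0) :
      coeff (fun _ => 1) k = if k = 0 then 1 else 0 := by
    have := coeff_phi (k := 0) (l := k) (by simp) hk
    simp only [eq_comm (a := (0 : Fin 3 → ℤ))] at this
    rw [← this]
    simp [coeff, phi]
  have : ∀ ν, m ν * ∑ k ∈ shell ν, coeff (fun _ => 1) k * phi k t = if ν = 0 then m ν else 0 := by
    intro ν
    have : ∀ k ∈ shell ν, coeff (fun _ => 1) k * phi k t = if 0 = k then 1 else 0 := by
      intro k hk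
      rw [hc k (mem_shell.1 hk).1]
      simp only [eq_comm (a := (0 : Fin 3 → ℤ))]
      split_ifs with h0
      · simp [h0, phi]
      · simp
    rw [Finset.sum_congr rfl this, Finset.sum_ite_eq]
    have hs : size 0 = 0 := by simp [size]
    simp [mem_shell, hs, eq_comm]
  simp only [this, tsum_ite_eq]

theorem size_neg (k : Fin 3 → ℤ) : size (-k) = size k := by
  simp [size]

/-- Evenness makes the convolution kernel symmetric in its two variables, so one marginal in Schur's
test gives the other. -/
theorem radialKernel_neg (m : ℕ → ℂ) (t : Fin 3 → ℝ) :
    radialKernel m (-t) = radialKernel m t := by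
  refine tsum_congr fun ν => ?_
  congr 1
  refine Finset.sum_equiv (Equiv.neg _) (fun k => ?_) fun k _ => ?_
  · simp only [mem_shell, Equiv.neg_apply, size_neg, Pi.neg_apply]
    constructor <;> (rintro ⟨h, h'⟩; exact ⟨by omega, h'⟩)
  · rw [phi_neg_right, conj_phi, Equiv.neg_apply]

theorem card_shell_le (ν : ℕ) : (shell ν).card ≤ (2 * ν + 1) ^ 3 := by
  refine (Finset.card_filter_le _ _).trans (le_of_eq ?_)
  rw [Fintype.card_piFinset]
  simp only [Int.card_Icc, Finset.prod_const, Finset.card_univ, Fintype.card_fin]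
  congr 1
  omega

theorem shellSummable_pow_mul_geometric (j : ℕ) {x : ℝ} (h0 : 0 ≤ x) (h1 : x < 1) :
    ShellSummable fun ν => (ν : ℂ) ^ j * (x : ℂ) ^ ν := by
  have hs (i : ℕ) : Summable fun ν : ℕ => (ν : ℝ) ^ i * x ^ ν :=
    summable_pow_mul_geometric_of_norm_lt_one i (by rwa [Real.norm_of_nonneg h0])
  refine Summable.of_nonneg_of_le (fun _ => by positivity) (fun ν => ?_)
    (((((hs (j + 3)).mul_left 8).add ((hs (j + 2)).mul_left 12)).add
      ((hs (j + 1)).mul_left 6)).add (hs j))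
  have hc : ((shell ν).card : ℝ) ≤ (2 * ν + 1) ^ 3 := by exact_mod_cast card_shell_le ν
  rw [norm_mul, norm_pow, norm_pow, Complex.norm_natCast, Complex.norm_real,
    Real.norm_of_nonneg h0]
  calc (ν : ℝ) ^ j * x ^ ν * (shell ν).card ≤ (ν : ℝ) ^ j * x ^ ν * (2 * ν + 1) ^ 3 := by gcongr
    _ = _ := by ring

/-! ### The one-dimensional Poisson kernel and its derivative -/

/-- The one-dimensional Poisson kernel. -/
noncomputable def poissonKernel (σ x : ℝ) : ℝ :=
  (1 - σ ^ 2) / ‖1 - (σ : ℂ) * Complex.exp (x * Complex.I)‖ ^ 2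

/-- The conjugate-symmetric kernel with Fourier coefficients `|k| σ ^ |k|`. -/
noncomputable def poissonDerivKernel (σ x : ℝ) : ℂ :=
  ∑' k : ℤ, (k.natAbs : ℂ) * (σ : ℂ) ^ k.natAbs * Complex.exp (k * x * Complex.I)

section OneDim

variable {σ : ℝ} (x : ℝ)

theorem hasSum_of_eq {ι : Type*} {f g : ι → ℂ} {s s' : ℂ} (h : HasSum f s) (hf : ∀ i, g i = f i)
    (hs : s' = s) : HasSum g s' := by
  rwa [hs, funext hf]

/-- The two half-series are conjugate, and both contain the term at 0, which is subtracted once. -/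
theorem hasSum_int_of_conj {f : ℤ → ℂ} {s : ℂ} (hs : HasSum (fun n : ℕ => f n) s)
    (hc : ∀ n : ℕ, f (-n) = starRingEnd ℂ (f n)) : HasSum f (s + starRingEnd ℂ s - f 0) := by
  have h2 : HasSum (fun n : ℕ => f (-((n : ℤ) + 1))) (starRingEnd ℂ s - f 0) := by
    have h3 : HasSum (fun n : ℕ => f (-(n : ℤ))) (starRingEnd ℂ s) := by
      simp only [hc]
      exact (Complex.hasSum_conj' ).2 (by simpa using hs)
    have := (hasSum_nat_add_iff' 1).2 h3
    simpa using this
  rw [add_sub_assoc]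
  exact HasSum.of_nat_of_neg_add_one hs h2

theorem norm_real_mul_exp (h0 : 0 ≤ σ) : ‖(σ : ℂ) * Complex.exp (x * Complex.I)‖ = σ := by
  rw [norm_mul, Complex.norm_exp_ofReal_mul_I, mul_one, Complex.norm_of_nonneg h0]

theorem pow_mul_exp_nat (n : ℕ) : (σ : ℂ) ^ (n : ℤ).natAbs *
    Complex.exp ((n : ℤ) * x * Complex.I) = ((σ : ℂ) * Complex.exp (x * Complex.I)) ^ n := by
  rw [mul_pow, ← Complex.exp_nat_mul, Int.natAbs_natCast]
  push_cast
  ring_nf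

theorem pow_mul_exp_neg (k : ℤ) : (σ : ℂ) ^ (-k).natAbs *
    Complex.exp ((-k : ℤ) * x * Complex.I) =
      starRingEnd ℂ ((σ : ℂ) ^ k.natAbs * Complex.exp (k * x * Complex.I)) := by
  rw [map_mul, map_pow, Complex.conj_ofReal, ← Complex.exp_conj]
  simp

theorem one_sub_ne_zero_of_norm {w : ℂ} (h : ‖w‖ < 1) : 1 - w ≠ 0 := by
  intro h'
  rw [sub_eq_zero] at h'
  rw [← h'] at h
  simp at h

theorem hasSum_poissonKernel (h0 : 0 ≤ σ) (h1 : σ < 1) :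
    HasSum (fun k : ℤ => (σ : ℂ) ^ k.natAbs * Complex.exp (k * x * Complex.I))
      (poissonKernel σ x : ℂ) := by
  set w : ℂ := (σ : ℂ) * Complex.exp (x * Complex.I) with hw
  have hn : ‖w‖ = σ := norm_real_mul_exp x h0
  have hs := hasSum_int_of_conj
    (f := fun k : ℤ => (σ : ℂ) ^ k.natAbs * Complex.exp (k * x * Complex.I)) (s := (1 - w)⁻¹) (by
      simp only [pow_mul_exp_nat]
      exact hasSum_geometric_of_norm_lt_one (by rwa [norm_real_mul_exp x h0]))
      (fun n => pow_mul_exp_neg x n)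
  convert hs using 1
  have hne : 1 - w ≠ 0 := one_sub_ne_zero_of_norm (by rwa [hn])
  have hne' : 1 - starRingEnd ℂ w ≠ 0 := one_sub_ne_zero_of_norm (by rwa [RCLike.norm_conj, hn])
  have hσ : (σ : ℂ) ^ 2 = w * starRingEnd ℂ w := by
    rw [Complex.mul_conj, Complex.normSq_eq_norm_sq, hn]
    push_cast
    rfl
  rw [poissonKernel, ← hw]
  push_cast
  have hd : (‖1 - w‖ : ℂ) ^ 2 = (1 - w) * (1 - starRingEnd ℂ w) := by
    rw [show (1 : ℂ) - starRingEnd ℂ w = starRingEnd ℂ (1 - w) by simp, Complex.mul_conj,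
      Complex.normSq_eq_norm_sq]
    push_cast
    rfl
  rw [hd, hσ]
  simp only [pow_zero, zero_mul, Complex.exp_zero, mul_one,
    map_inv₀, map_sub, map_one]
  field_simp
  ring

theorem poissonKernel_nonneg (h0 : 0 ≤ σ) (h1 : σ < 1) : 0 ≤ poissonKernel σ x := by
  have : σ ^ 2 ≤ 1 := by nlinarith
  unfold poissonKernel
  have : 0 ≤ 1 - σ ^ 2 := by linarith
  positivity

/-- With w = σe^(ix), the series sums to w/(1 - w)² plus its conjugate, and 2σ ≤ 1 + σ = (1 - σ²)/(1
- σ). A pointwise bound by the Poisson kernel, rather than an L₁ bound, is what survives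
multiplication by the two other kernels. -/
theorem norm_poissonDerivKernel_le (h0 : 0 ≤ σ) (h1 : σ < 1) :
    ‖poissonDerivKernel σ x‖ ≤ (1 - σ)⁻¹ * poissonKernel σ x := by
  set w : ℂ := (σ : ℂ) * Complex.exp (x * Complex.I) with hw
  have hn : ‖w‖ = σ := norm_real_mul_exp x h0
  have hs := hasSum_int_of_conj
    (f := fun k : ℤ => (k.natAbs : ℂ) * (σ : ℂ) ^ k.natAbs * Complex.exp (k * x * Complex.I))
    (s := w / (1 - w) ^ 2) (by
      have := hasSum_coe_mul_geometric_of_norm_lt_one (r := w) (by rwa [hn])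
      refine hasSum_of_eq this (fun n => ?_) rfl
      rw [mul_assoc, pow_mul_exp_nat]
      simp [hw])
      (fun n => by
        rw [mul_assoc, pow_mul_exp_neg]
        simp only [Int.natAbs_neg, map_mul, map_natCast]
        ring)
  rw [poissonDerivKernel, hs.tsum_eq]
  have hd : 0 < ‖1 - w‖ := norm_pos_iff.2 (one_sub_ne_zero_of_norm (by rwa [hn]))
  have h1' : 0 < 1 - σ := by linarith
  calc _ ≤ ‖w / (1 - w) ^ 2‖ + ‖starRingEnd ℂ (w / (1 - w) ^ 2)‖ := by
        simpa only [Int.natAbs_zero, Nat.cast_zero, zero_mul, sub_zero] using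
          norm_add_le (w / (1 - w) ^ 2) (starRingEnd ℂ (w / (1 - w) ^ 2))
    _ = 2 * σ / ‖1 - w‖ ^ 2 := by
        rw [RCLike.norm_conj, norm_div, norm_pow, hn]; ring
    _ ≤ (1 + σ) / ‖1 - w‖ ^ 2 := by gcongr; linarith
    _ = _ := by
        rw [poissonKernel, ← hw]
        field_simp
        ring

theorem summable_norm_poisson (j : ℕ) (h0 : 0 ≤ σ) (h1 : σ < 1) :
    Summable fun k : ℤ => ‖(k.natAbs : ℂ) ^ j * (σ : ℂ) ^ k.natAbs‖ := by
  have : Summable fun n : ℕ => ‖(n : ℂ) ^ j * (σ : ℂ) ^ n‖ := by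
    have := summable_pow_mul_geometric_of_norm_lt_one j (r := σ) (by rwa [Real.norm_of_nonneg h0])
    refine this.congr fun n => ?_
    simp [abs_of_nonneg h0]
  refine Summable.of_nat_of_neg ?_ ?_
  · simpa using this
  · simpa using this

theorem continuous_poissonKernel (h0 : 0 ≤ σ) (h1 : σ < 1) : Continuous (poissonKernel σ) := by
  unfold poissonKernel
  refine Continuous.div (by fun_prop) (by fun_prop) fun x => ?_
  exact pow_ne_zero _ (norm_ne_zero_iff.2
    (one_sub_ne_zero_of_norm (by rwa [norm_real_mul_exp x h0])))

end OneDim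

/-! ### Diagonal averages of products of three Fourier series -/

theorem integral_exp_int (n : ℤ) : ∫ θ in Set.Ioc 0 (2 * Real.pi),
    Complex.exp (n * θ * Complex.I) = if n = 0 then 2 * Real.pi else 0 := by
  rw [← intervalIntegral.integral_of_le Real.two_pi_pos.le]
  split_ifs with h
  · simp [h]
  · have : ∀ θ : ℝ, (n : ℂ) * θ * Complex.I = (n * Complex.I) * θ := fun θ => by ring
    simp only [this]
    refine integral_exp_interval (by simp [h]) ?_
    rw [Complex.exp_eq_one_iff]
    exact ⟨n, by push_cast; ring⟩

/-- The product of three Fourier series, integrated along the diagonal, keeps the frequencies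
with vanishing sum. -/
theorem hasSum_diagonal {a b c : ℤ → ℂ} (ha : Summable fun k => ‖a k‖)
    (hb : Summable fun k => ‖b k‖) (hc : Summable fun k => ‖c k‖) (x y z : ℝ) :
    HasSum (fun q : ℤ × ℤ × ℤ => if q.1 + q.2.1 + q.2.2 = 0 then
        2 * Real.pi * (a q.1 * b q.2.1 * c q.2.2 * Complex.exp ((q.1 * x + q.2.1 * y + q.2.2 * z) *
          Complex.I)) else 0)
      (∫ θ in Set.Ioc 0 (2 * Real.pi),
        (∑' k : ℤ, a k * Complex.exp (k * (x + θ : ℝ) * Complex.I)) *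
        ((∑' k : ℤ, b k * Complex.exp (k * (y + θ : ℝ) * Complex.I)) *
        (∑' k : ℤ, c k * Complex.exp (k * (z + θ : ℝ) * Complex.I)))) := by
  have hE (k : ℤ) (y : ℝ) : ‖Complex.exp (k * (y : ℝ) * Complex.I)‖ = 1 := by
    rw [show (k : ℂ) * y = ((k * y : ℝ) : ℂ) by push_cast; rfl]
    exact Complex.norm_exp_ofReal_mul_I _
  have hsum {a : ℤ → ℂ} (ha : Summable fun k => ‖a k‖) (y : ℝ) :
      Summable fun k : ℤ => ‖a k * Complex.exp (k * (y : ℝ) * Complex.I)‖ := by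
    simpa only [norm_mul, hE, mul_one] using ha
  set G : ℤ × ℤ × ℤ → ℝ → ℂ := fun q θ => (a q.1 * Complex.exp (q.1 * (x + θ : ℝ) * Complex.I)) *
    ((b q.2.1 * Complex.exp (q.2.1 * (y + θ : ℝ) * Complex.I)) *
      (c q.2.2 * Complex.exp (q.2.2 * (z + θ : ℝ) * Complex.I))) with hG
  have hGn (q : ℤ × ℤ × ℤ) (θ : ℝ) : ‖G q θ‖ = ‖a q.1 * (b q.2.1 * c q.2.2)‖ := by
    simp only [hG, norm_mul, hE, mul_one]
  have hGc (q : ℤ × ℤ × ℤ) : Continuous (G q) := by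
    simp only [hG]; fun_prop
  have key := hasSum_integral_of_summable_integral_norm
    (μ := volume.restrict (Set.Ioc 0 (2 * Real.pi))) (F := G)
    (fun q => ((hGc q).continuousOn.integrableOn_Icc).mono_set Set.Ioc_subset_Icc_self)
    (by
      simp only [hGn]
      simp only [integral_const]
      exact (ha.mul_norm (f := a) (g := fun q : ℤ × ℤ => b q.1 * c q.2)
        (hb.mul_norm hc)).const_smul _)
  refine hasSum_of_eq key (fun q => ?_) ?_
  · have hq (θ : ℝ) : G q θ = (a q.1 * b q.2.1 * c q.2.2 *
        Complex.exp ((q.1 * x + q.2.1 * y + q.2.2 * z) * Complex.I)) *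
        Complex.exp ((q.1 + q.2.1 + q.2.2 : ℤ) * θ * Complex.I) := by
      have : Complex.exp ((q.1 * x + q.2.1 * y + q.2.2 * z) * Complex.I) *
          Complex.exp ((q.1 + q.2.1 + q.2.2 : ℤ) * θ * Complex.I) =
          Complex.exp (q.1 * (x + θ : ℝ) * Complex.I) *
          (Complex.exp (q.2.1 * (y + θ : ℝ) * Complex.I) *
          Complex.exp (q.2.2 * (z + θ : ℝ) * Complex.I)) := by
        rw [← Complex.exp_add, ← Complex.exp_add, ← Complex.exp_add]
        congr 1
        push_cast
        ring
      rw [mul_assoc, this]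
      simp only [hG]
      ring
    simp only [hq]
    rw [integral_const_mul, integral_exp_int]
    split_ifs <;> push_cast <;> ring
  · congr 1
    funext θ
    rw [tsum_mul_tsum_of_summable_norm (hsum hb _) (hsum hc _),
      tsum_mul_tsum_of_summable_norm (hsum ha _) ((hsum hb _).mul_norm (hsum hc _))]

theorem size_eq (k : Fin 3 → ℤ) :
    size k = max (k 0).natAbs (max (k 1).natAbs (k 2).natAbs) := by
  simp [size, Fin.univ_succ]

/-- The entry of largest modulus is minus the sum of the two others, which do not have opposite
signs. This is what factors the hexagonal kernel into one-dimensional ones. -/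
theorem natAbs_add_natAbs_add_natAbs {k : Fin 3 → ℤ} (hk : k 0 + k 1 + k 2 = 0) :
    (k 0).natAbs + (k 1).natAbs + (k 2).natAbs = 2 * size k := by
  rw [size_eq]
  omega

theorem hasSum_shell {c : (Fin 3 → ℤ) → ℂ} {s : ℂ}
    (h : HasSum (fun k : Fin 3 → ℤ => if k 0 + k 1 + k 2 = 0 then c k else 0) s) :
    HasSum (fun ν => ∑ k ∈ shell ν, c k) s := by
  have h2 := (Equiv.sigmaFiberEquiv size).hasSum_iff.2 h
  refine h2.sigma fun ν => ?_
  change HasSum ((fun k : Fin 3 → ℤ => if k 0 + k 1 + k 2 = 0 then c k else 0) ∘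
    (Subtype.val : {k // size k = ν} → _)) _
  have := hasSum_subtype_iff_indicator (s := {k | size k = ν})
    (f := fun k : Fin 3 → ℤ => if k 0 + k 1 + k 2 = 0 then c k else 0)
    (a := ∑ k ∈ shell ν, c k)
  refine this.2 ?_
  have heq : ∑ k ∈ shell ν, c k = ∑ k ∈ shell ν, Set.indicator {k | size k = ν}
      (fun k : Fin 3 → ℤ => if k 0 + k 1 + k 2 = 0 then c k else 0) k := by
    refine Finset.sum_congr rfl fun k hk => ?_
    obtain ⟨h0, h1⟩ := mem_shell.1 hk
    rw [Set.indicator_of_mem (by exact h1), if_pos h0]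
  rw [heq]
  refine hasSum_sum_of_ne_finset_zero (fun k hk => ?_)
  by_cases h1 : size k = ν
  · rw [Set.indicator_of_mem (by exact h1), if_neg]
    exact fun h0 => hk (mem_shell.2 ⟨h0, h1⟩)
  · exact Set.indicator_of_notMem (s := {k | size k = ν}) h1 _

/-- At the angles 2πt_j/3 the product of exponentials is φ_k(t). Averaging over a common shift θ
selects the plane k₁ + k₂ + k₃ = 0, which is then summed shell by shell. -/
theorem hasSum_shell_diagonal {a b c : ℤ → ℂ} (ha : Summable fun k => ‖a k‖)
    (hb : Summable fun k => ‖b k‖) (hc : Summable fun k => ‖c k‖) (t : Fin 3 → ℝ) :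
    HasSum (fun ν => ∑ k ∈ shell ν, 2 * Real.pi * (a (k 0) * b (k 1) * c (k 2) * phi k t))
      (∫ θ in Set.Ioc 0 (2 * Real.pi),
        (∑' k : ℤ, a k * Complex.exp (k * (2 * Real.pi / 3 * t 0 + θ : ℝ) * Complex.I)) *
        ((∑' k : ℤ, b k * Complex.exp (k * (2 * Real.pi / 3 * t 1 + θ : ℝ) * Complex.I)) *
        (∑' k : ℤ, c k * Complex.exp (k * (2 * Real.pi / 3 * t 2 + θ : ℝ) * Complex.I)))) := by
  refine hasSum_shell ?_
  let e : ℤ × ℤ × ℤ ≃ (Fin 3 → ℤ) :=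
    { toFun := fun q => ![q.1, q.2.1, q.2.2]
      invFun := fun k => (k 0, k 1, k 2)
      left_inv := fun q => rfl
      right_inv := fun k => by funext j; fin_cases j <;> rfl }
  refine e.hasSum_iff.1 ?_
  refine hasSum_of_eq (hasSum_diagonal ha hb hc (2 * Real.pi / 3 * t 0) (2 * Real.pi / 3 * t 1)
    (2 * Real.pi / 3 * t 2)) (fun q => ?_) rfl
  have h0 : e q 0 = q.1 := rfl
  have h1 : e q 1 = q.2.1 := rfl
  have h2 : e q 2 = q.2.2 := rfl
  have hphi : phi (e q) t = Complex.exp ((q.1 * (2 * Real.pi / 3 * t 0 : ℝ) +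
      q.2.1 * (2 * Real.pi / 3 * t 1 : ℝ) + q.2.2 * (2 * Real.pi / 3 * t 2 : ℝ)) *
        Complex.I) := by
    rw [phi, Fin.sum_univ_three, h0, h1, h2]
    congr 1
    push_cast
    ring
  rw [Function.comp_apply, h0, h1, h2, hphi]

/-! ### The hexagonal Poisson kernel -/

/-- The Poisson kernel of the hexagon, with multiplier `σ ^ (2 * |k|)`. -/
noncomputable def hexPoisson (σ : ℝ) (t : Fin 3 → ℝ) : ℝ :=
  (2 * Real.pi)⁻¹ * ∫ θ in Set.Ioc 0 (2 * Real.pi),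
    poissonKernel σ (2 * Real.pi / 3 * t 0 + θ) *
      (poissonKernel σ (2 * Real.pi / 3 * t 1 + θ) * poissonKernel σ (2 * Real.pi / 3 * t 2 + θ))

section HexPoisson

variable {σ : ℝ} 

theorem hexPoisson_nonneg (h0 : 0 ≤ σ) (h1 : σ < 1) (t : Fin 3 → ℝ) : 0 ≤ hexPoisson σ t := by
  refine mul_nonneg (by positivity) (integral_nonneg fun θ => ?_)
  exact mul_nonneg (poissonKernel_nonneg _ h0 h1)
    (mul_nonneg (poissonKernel_nonneg _ h0 h1) (poissonKernel_nonneg _ h0 h1))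

theorem radialKernel_eq_hexPoisson (h0 : 0 ≤ σ) (h1 : σ < 1) (t : Fin 3 → ℝ) :
    radialKernel (fun ν => (σ : ℂ) ^ (2 * ν)) t = hexPoisson σ t := by
  have hs : Summable fun k : ℤ => ‖(σ : ℂ) ^ k.natAbs‖ := by
    simpa using summable_norm_poisson 0 h0 h1
  have key := hasSum_shell_diagonal hs hs hs t
  simp only [(hasSum_poissonKernel _ h0 h1).tsum_eq] at key
  rw [radialKernel, hexPoisson, Complex.ofReal_mul, ← integral_complex_ofReal]
  push_cast
  rw [← key.tsum_eq, ← tsum_mul_left]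
  refine tsum_congr fun ν => ?_
  rw [← Finset.mul_sum, ← mul_assoc, inv_mul_cancel₀ (by simp [Real.pi_ne_zero]), one_mul,
    Finset.mul_sum]
  refine Finset.sum_congr rfl fun k hk => ?_
  obtain ⟨hk0, hk1⟩ := mem_shell.1 hk
  rw [← pow_add, ← pow_add, natAbs_add_natAbs_add_natAbs hk0, hk1]

/-- A Leibniz rule: |k| is half of |k₁| + |k₂| + |k₃|, so the kernel is half the sum of three
diagonal averages, each with one Poisson kernel replaced by its derivative kernel. Each is at most
(1 - σ)⁻¹ times the positive kernel. -/
theorem norm_radialKernel_deriv_le (h0 : 0 ≤ σ) (h1 : σ < 1) (t : Fin 3 → ℝ) :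
    ‖radialKernel (fun ν => (ν : ℂ) * (σ : ℂ) ^ (2 * ν)) t‖ ≤
      3 / (2 * (1 - σ)) * hexPoisson σ t := by
  have hs : Summable fun k : ℤ => ‖(σ : ℂ) ^ k.natAbs‖ := by
    simpa using summable_norm_poisson 0 h0 h1
  have hd : Summable fun k : ℤ => ‖(k.natAbs : ℂ) * (σ : ℂ) ^ k.natAbs‖ := by
    simpa using summable_norm_poisson 1 h0 h1
  have key := ((hasSum_shell_diagonal hd hs hs t).add (hasSum_shell_diagonal hs hd hs t)).add
    (hasSum_shell_diagonal hs hs hd t)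
  simp only [(hasSum_poissonKernel _ h0 h1).tsum_eq, ← Finset.sum_add_distrib] at key
  have hp : Continuous (poissonKernel σ) := continuous_poissonKernel h0 h1
  have hI : IntegrableOn (fun θ => (1 - σ)⁻¹ * (poissonKernel σ (2 * Real.pi / 3 * t 0 + θ) *
      (poissonKernel σ (2 * Real.pi / 3 * t 1 + θ) *
        poissonKernel σ (2 * Real.pi / 3 * t 2 + θ)))) (Set.Ioc 0 (2 * Real.pi)) := by
    refine (Continuous.integrableOn_Icc ?_).mono_set Set.Ioc_subset_Icc_self
    fun_prop
  have hpos (x) := poissonKernel_nonneg (σ := σ) x h0 h1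
  have hnp (x) : ‖(poissonKernel σ x : ℂ)‖ = poissonKernel σ x :=
    Complex.norm_of_nonneg (hpos x)
  have hnd (x) := norm_poissonDerivKernel_le (σ := σ) x h0 h1
  have hval : ∫ θ in Set.Ioc 0 (2 * Real.pi), (1 - σ)⁻¹ *
      (poissonKernel σ (2 * Real.pi / 3 * t 0 + θ) * (poissonKernel σ (2 * Real.pi / 3 * t 1 + θ) *
        poissonKernel σ (2 * Real.pi / 3 * t 2 + θ))) =
      (1 - σ)⁻¹ * (2 * Real.pi) * hexPoisson σ t := by
    rw [integral_const_mul, hexPoisson, mul_assoc, ← mul_assoc (2 * Real.pi),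
      mul_inv_cancel₀ Real.two_pi_pos.ne', one_mul]
  -- In (4π)⁻¹, 2π normalises the diagonal integral and the extra 2 comes from |k₁| + |k₂| + |k₃| =
  -- 2|k|.
  refine (le_of_eq (congrArg norm (Eq.trans ?_
    (congrArg (fun z => (4 * Real.pi : ℂ)⁻¹ * z) key.tsum_eq)))).trans ?_
  · simp only [radialKernel, ← tsum_mul_left]
    refine tsum_congr fun ν => ?_
    rw [Finset.mul_sum, Finset.mul_sum]
    refine Finset.sum_congr rfl fun k hk => ?_
    obtain ⟨hk0, hk1⟩ := mem_shell.1 hk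
    have hn := natAbs_add_natAbs_add_natAbs hk0
    have hc : ((k 0).natAbs : ℂ) + (k 1).natAbs + (k 2).natAbs = 2 * ν := by
      rw [← hk1]; exact_mod_cast hn
    rw [← hk1, ← hn, pow_add, pow_add, hk1]
    rw [show (ν : ℂ) = (((k 0).natAbs : ℂ) + (k 1).natAbs + (k 2).natAbs) / 2 by
      rw [hc]; ring]
    have := Real.pi_ne_zero
    field_simp
    ring
  rw [norm_mul]
  have hsum {u v w : ℂ} {M : ℝ} (hu : ‖u‖ ≤ M) (hv : ‖v‖ ≤ M) (hw : ‖w‖ ≤ M) :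
      ‖u + v + w‖ ≤ 3 * M :=
    (norm_add₃_le).trans (by linarith)
  calc _ ≤ (4 * Real.pi)⁻¹ * (3 * ((1 - σ)⁻¹ * (2 * Real.pi) * hexPoisson σ t)) := by
        have hpi : ‖(4 * Real.pi : ℂ)⁻¹‖ = (4 * Real.pi)⁻¹ := by
          simp [abs_of_pos Real.pi_pos]
        rw [hpi]
        gcongr
        refine hsum ?_ ?_ ?_
        all_goals
          rw [← hval]
          refine norm_integral_le_of_norm_le hI (Eventually.of_forall fun θ => ?_)
          simp only [norm_mul, hnp]
        · refine (mul_le_mul_of_nonneg_right (hnd _)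
            (mul_nonneg (hpos _) (hpos _))).trans (le_of_eq (by ring))
        · refine (mul_le_mul_of_nonneg_left (mul_le_mul_of_nonneg_right (hnd _) (hpos _))
            (hpos _)).trans (le_of_eq (by ring))
        · refine (mul_le_mul_of_nonneg_left (mul_le_mul_of_nonneg_left (hnd _) (hpos _))
            (hpos _)).trans (le_of_eq (by ring))
    _ = _ := by
        have := Real.pi_ne_zero
        have : 1 - σ ≠ 0 := by linarith
        field_simp
        ring

end HexPoisson

/-! ### Schur's test and domination by the Poisson kernel -/

/-- Jensen's inequality, obtained from the monotonicity of L_p norms in p for the probability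
measure with density k. -/
theorem rpow_lintegral_mul_le {α : Type*} [MeasurableSpace α] {μ : Measure α} {f : α → ℂ}
    (hf : AEStronglyMeasurable f μ) {k : α → ℝ≥0∞} (hk : Measurable k)
    (h1 : ∫⁻ s, k s ∂μ = 1) {r : ℝ} (hr : 1 ≤ r) :
    (∫⁻ s, k s * ‖f s‖ₑ ∂μ) ^ r ≤ ∫⁻ s, k s * ‖f s‖ₑ ^ r ∂μ := by
  have hr0 : 0 < r := by linarith
  have hprob : IsProbabilityMeasure (μ.withDensity k) := ⟨by simp [h1]⟩
  have hac := withDensity_absolutelyContinuous μ k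
  have := eLpNorm_le_eLpNorm_of_exponent_le (μ := μ.withDensity k) (p := 1)
    (q := ENNReal.ofReal r) (by simpa using hr) (hf.mono_ac hac)
  rw [eLpNorm_one_eq_lintegral_enorm, eLpNorm_eq_lintegral_rpow_enorm_toReal
    (by simpa using hr0) ENNReal.ofReal_ne_top, ENNReal.toReal_ofReal hr0.le,
    lintegral_withDensity_eq_lintegral_mul₀ hk.aemeasurable hf.enorm,
    lintegral_withDensity_eq_lintegral_mul₀ hk.aemeasurable (hf.enorm.pow_const r)] at this
  refine (ENNReal.rpow_le_rpow this hr0.le).trans (le_of_eq ?_)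
  rw [← ENNReal.rpow_mul, one_div, inv_mul_cancel₀ hr0.ne', ENNReal.rpow_one]
  rfl

/-- Schur's test for a doubly stochastic kernel. -/
theorem eLpNorm_le_of_kernel {α : Type*} [MeasurableSpace α] {μ : Measure α} [SFinite μ]
    {f g : α → ℂ} (hf : AEStronglyMeasurable f μ)
    {k : α → α → ℝ≥0∞} (hk : Measurable (Function.uncurry k))
    (h1 : ∀ t, ∫⁻ s, k t s ∂μ = 1) (h2 : ∀ s, ∫⁻ t, k t s ∂μ = 1) {C : ℝ≥0∞}
    (hg : ∀ t, ‖g t‖ₑ ≤ C * ∫⁻ s, k t s * ‖f s‖ₑ ∂μ) {p : ℝ≥0∞} (hp : 1 ≤ p) :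
    eLpNorm g p μ ≤ C * eLpNorm f p μ := by
  rcases eq_or_ne p ∞ with rfl | hpt
  · rw [eLpNorm_exponent_top, eLpNorm_exponent_top]
    refine eLpNormEssSup_le_of_ae_enorm_bound (Eventually.of_forall fun t => (hg t).trans ?_)
    gcongr
    calc ∫⁻ s, k t s * ‖f s‖ₑ ∂μ ≤ ∫⁻ s, k t s * eLpNormEssSup f μ ∂μ := by
          refine lintegral_mono_ae ?_
          filter_upwards [ae_le_eLpNormEssSup (f := f) (μ := μ)] with s hs
          gcongr
      _ = eLpNormEssSup f μ := by
          rw [lintegral_mul_const _ hk.of_uncurry_left, h1, one_mul]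
  have hp0 : p ≠ 0 := (zero_lt_one.trans_le hp).ne'
  have hr : 1 ≤ p.toReal := by
    simpa using ENNReal.toReal_mono hpt hp
  have hr0 : 0 < p.toReal := by linarith
  rw [eLpNorm_eq_lintegral_rpow_enorm_toReal hp0 hpt, eLpNorm_eq_lintegral_rpow_enorm_toReal hp0 hpt]
  set r := p.toReal
  -- Jensen uses the first marginal; Tonelli and the second marginal then remove the kernel.
  calc (∫⁻ t, ‖g t‖ₑ ^ r ∂μ) ^ (1 / r)
      ≤ (∫⁻ t, C ^ r * ∫⁻ s, k t s * ‖f s‖ₑ ^ r ∂μ ∂μ) ^ (1 / r) := by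
        gcongr with t
        refine (ENNReal.rpow_le_rpow (hg t) hr0.le).trans ?_
        rw [ENNReal.mul_rpow_of_nonneg _ _ hr0.le]
        gcongr
        exact rpow_lintegral_mul_le hf hk.of_uncurry_left (h1 t) hr
    _ ≤ (C ^ r * ∫⁻ s, ‖f s‖ₑ ^ r ∂μ) ^ (1 / r) := by
        gcongr
        have hm : AEMeasurable (Function.uncurry fun t s => k t s * ‖f s‖ₑ ^ r) (μ.prod μ) :=
          hk.aemeasurable.mul ((hf.enorm.pow_const r).comp_snd)
        have hm' : AEMeasurable (fun t => ∫⁻ s, k t s * ‖f s‖ₑ ^ r ∂μ) μ :=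
          hm.lintegral_prod_right'
        rw [lintegral_const_mul'' _ hm', lintegral_lintegral_swap hm]
        gcongr with s
        rw [lintegral_mul_const _ hk.of_uncurry_right, h2, one_mul]
    _ = C * (∫⁻ s, ‖f s‖ₑ ^ r ∂μ) ^ (1 / r) := by
        rw [ENNReal.mul_rpow_of_nonneg _ _ (by positivity), ← ENNReal.rpow_mul, one_div,
          mul_inv_cancel₀ hr0.ne', ENNReal.rpow_one]

section HexPoisson

variable {σ : ℝ}

theorem shellSummable_poisson (j : ℕ) (h0 : 0 ≤ σ) (h1 : σ < 1) :
    ShellSummable fun ν => (ν : ℂ) ^ j * (σ : ℂ) ^ (2 * ν) := by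
  have := shellSummable_pow_mul_geometric j (x := σ ^ 2) (by positivity) (by nlinarith)
  simpa only [Complex.ofReal_pow, ← pow_mul] using this

theorem shellSummable_sq_pow (h0 : 0 ≤ σ) (h1 : σ < 1) :
    ShellSummable fun ν => (σ : ℂ) ^ (2 * ν) := by
  simpa using shellSummable_poisson 0 h0 h1

theorem hexPoisson_eq_re (h0 : 0 ≤ σ) (h1 : σ < 1) :
    hexPoisson σ = fun t => (radialKernel (fun ν => (σ : ℂ) ^ (2 * ν)) t).re := by
  funext t
  rw [radialKernel_eq_hexPoisson h0 h1, Complex.ofReal_re]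

theorem continuous_hexPoisson (h0 : 0 ≤ σ) (h1 : σ < 1) : Continuous (hexPoisson σ) := by
  rw [hexPoisson_eq_re h0 h1]
  exact Complex.continuous_re.comp (shellSummable_sq_pow h0 h1).continuous_radialKernel

theorem hexPoisson_neg (h0 : 0 ≤ σ) (h1 : σ < 1) (t : Fin 3 → ℝ) :
    hexPoisson σ (-t) = hexPoisson σ t := by
  simp only [hexPoisson_eq_re h0 h1, radialKernel_neg]

theorem lintegral_hexPoisson_sub (h0 : 0 ≤ σ) (h1 : σ < 1) (t : Fin 3 → ℝ) :
    ∫⁻ s, ENNReal.ofReal (hexPoisson σ (t - s)) ∂hexMeasure = 1 := by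
  have hs := shellSummable_sq_pow h0 h1
  have hI := integral_radialKernel_sub hs t
  simp only [radialKernel_eq_hexPoisson h0 h1, mul_zero, pow_zero] at hI
  rw [integral_complex_ofReal] at hI
  have hI' : ∫ s, hexPoisson σ (t - s) ∂hexMeasure = 1 := by exact_mod_cast hI
  rw [← ofReal_integral_eq_lintegral_ofReal, hI', ENNReal.ofReal_one]
  -- A nonintegrable function would have Bochner integral 0, not 1.
  · by_contra h
    rw [integral_undef h] at hI'
    exact zero_ne_one hI'
  · exact Eventually.of_forall fun s => hexPoisson_nonneg h0 h1 _

theorem eLpNorm_radialMul_le_of_kernel (h0 : 0 ≤ σ) (h1 : σ < 1) {m : ℕ → ℂ}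
    (hm : ShellSummable m) {C : ℝ} (hC : 0 ≤ C)
    (hle : ∀ t, ‖radialKernel m t‖ ≤ C * hexPoisson σ t)
    {p : ℝ≥0∞} (hp : 1 ≤ p) {f : (Fin 3 → ℝ) → ℂ} (hf : MemLp f p hexMeasure) :
    eLpNorm (radialMul m f) p hexMeasure ≤ ENNReal.ofReal C * eLpNorm f p hexMeasure := by
  have hc := continuous_hexPoisson h0 h1
  refine eLpNorm_le_of_kernel hf.1 (k := fun t s => ENNReal.ofReal (hexPoisson σ (t - s)))
    ?_ (lintegral_hexPoisson_sub h0 h1) (fun s => ?_) (fun t => ?_) hp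
  · exact (ENNReal.continuous_ofReal.comp
      (hc.comp (continuous_fst.sub continuous_snd))).measurable
  · rw [← lintegral_hexPoisson_sub h0 h1 s]
    refine lintegral_congr fun t => ?_
    rw [← hexPoisson_neg h0 h1, neg_sub]
  · rw [radialMul_eq_integral hm (hf.integrable hp)]
    refine (enorm_integral_le_lintegral_enorm _).trans ?_
    rw [← lintegral_const_mul' _ _ ENNReal.ofReal_ne_top]
    refine lintegral_mono fun s => ?_
    rw [← mul_assoc, ← ENNReal.ofReal_mul hC, enorm_mul, mul_comm]
    gcongr
    rw [← ofReal_norm]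
    exact ENNReal.ofReal_le_ofReal (hle _)

end HexPoisson

/-! ### The calculus of L_p multipliers -/

/-- The multiplier `m (|k|)` is bounded on every `L_p` with norm at most `C`. -/
structure IsMultiplier (m : ℕ → ℂ) (C : ℝ) : Prop where
  nonneg : 0 ≤ C
  summable : ShellSummable m
  bound : ∀ {p : ℝ≥0∞}, 1 ≤ p → ∀ {f : (Fin 3 → ℝ) → ℂ}, MemLp f p hexMeasure →
    eLpNorm (radialMul m f) p hexMeasure ≤ ENNReal.ofReal C * eLpNorm f p hexMeasure

namespace IsMultiplier

variable {m m' : ℕ → ℂ} {C C' : ℝ}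

theorem mono (h : IsMultiplier m C) (hle : C ≤ C') : IsMultiplier m C' :=
  ⟨h.nonneg.trans hle, h.summable, fun hp _ hf => (h.bound hp hf).trans (by gcongr)⟩

theorem mul (h : IsMultiplier m C) (h' : IsMultiplier m' C') :
    IsMultiplier (fun ν => m ν * m' ν) (C * C') := by
  refine ⟨mul_nonneg h.nonneg h'.nonneg, h.summable.mul h'.summable, fun {p} hp {f} hf => ?_⟩
  rw [← radialMul_radialMul h'.summable, ENNReal.ofReal_mul h.nonneg, mul_assoc]
  refine (h.bound hp (h'.summable.memLp_radialMul f p)).trans ?_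
  gcongr
  exact h'.bound hp hf

theorem add (h : IsMultiplier m C) (h' : IsMultiplier m' C') :
    IsMultiplier (fun ν => m ν + m' ν) (C + C') := by
  refine ⟨add_nonneg h.nonneg h'.nonneg, h.summable.add h'.summable, fun {p} hp {f} hf => ?_⟩
  rw [radialMul_add_left h.summable h'.summable, ENNReal.ofReal_add h.nonneg h'.nonneg, add_mul]
  refine (eLpNorm_add_le (h.summable.continuous_radialMul f).aestronglyMeasurable
    (h'.summable.continuous_radialMul f).aestronglyMeasurable hp).trans ?_
  gcongr
  · exact h.bound hp hf
  · exact h'.bound hp hf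

theorem const_mul (h : IsMultiplier m C) (c : ℂ) : IsMultiplier (fun ν => c * m ν) (‖c‖ * C) := by
  refine ⟨mul_nonneg (norm_nonneg c) h.nonneg, h.summable.const_mul c, fun {p} hp {f} hf => ?_⟩
  rw [radialMul_const_mul_left, eLpNorm_const_smul, ENNReal.ofReal_mul (norm_nonneg c), mul_assoc,
    ofReal_norm]
  gcongr
  exact h.bound hp hf

theorem zero : IsMultiplier (fun _ => 0) 0 := by
  refine ⟨le_rfl, by simp [ShellSummable], fun hp f hf => ?_⟩
  have : radialMul (fun _ => 0) f = 0 := by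
    funext t; simp [radialMul]
  simp [this]

theorem sum {ι : Type*} {M : ι → ℕ → ℂ} {B : ι → ℝ} (s : Finset ι)
    (h : ∀ i ∈ s, IsMultiplier (M i) (B i)) :
    IsMultiplier (fun ν => ∑ i ∈ s, M i ν) (∑ i ∈ s, B i) := by
  classical
  induction s using Finset.induction_on with
  | empty => simpa using zero
  | insert a s ha ih =>
    simp only [Finset.sum_insert ha]
    exact (h a (by simp)).add (ih fun i hi => h i (by simp [hi]))

end IsMultiplier

theorem isMultiplier_sq_pow {σ : ℝ} (h0 : 0 ≤ σ) (h1 : σ < 1) :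
    IsMultiplier (fun ν => (σ : ℂ) ^ (2 * ν)) 1 := by
  refine ⟨zero_le_one, shellSummable_sq_pow h0 h1, fun hp f hf =>
    eLpNorm_radialMul_le_of_kernel h0 h1 (shellSummable_sq_pow h0 h1) zero_le_one (fun t => ?_)
      hp hf⟩
  rw [radialKernel_eq_hexPoisson h0 h1, one_mul,
    Complex.norm_of_nonneg (hexPoisson_nonneg h0 h1 t)]

theorem isMultiplier_mul_sq_pow {σ : ℝ} (h0 : 0 ≤ σ) (h1 : σ < 1) :
    IsMultiplier (fun ν => (ν : ℂ) * (σ : ℂ) ^ (2 * ν)) (3 / (2 * (1 - σ))) := by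
  have hs : ShellSummable (fun ν => (ν : ℂ) * (σ : ℂ) ^ (2 * ν)) := by
    simpa using shellSummable_poisson 1 h0 h1
  have hC : 0 ≤ 3 / (2 * (1 - σ)) := div_nonneg (by norm_num) (by linarith)
  exact ⟨hC, hs, fun hp f hf => eLpNorm_radialMul_le_of_kernel h0 h1 hs hC
    (norm_radialKernel_deriv_le h0 h1) hp hf⟩

/-- Falling factorials of order `i` cost a factor `(1 - σ)⁻¹` for each linear factor. -/
theorem isMultiplier_descFactorial_mul {σ : ℝ} (h0 : 0 ≤ σ) (h1 : σ < 1) {m : ℕ → ℂ} {C : ℝ}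
    (hm : IsMultiplier m C) (i : ℕ) : IsMultiplier
      (fun ν => (ν.descFactorial i : ℂ) * (σ : ℂ) ^ (2 * i * ν) * m ν)
      (((2 + i) / (1 - σ)) ^ i * C) := by
  have h1' : 0 < 1 - σ := by linarith
  -- The constant keeps i fixed while j varies, so every induction step contributes the same factor.
  suffices H : ∀ j ≤ i, IsMultiplier
      (fun ν => (ν.descFactorial j : ℂ) * (σ : ℂ) ^ (2 * j * ν) * m ν)
      (((2 + i) / (1 - σ)) ^ j * C) from H i le_rfl
  intro j hj
  induction j with
  | zero => simpa using hm
  | succ j ih =>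
    -- The new linear factor ν - j, damped by one copy of σ^(2ν).
    have hlin : IsMultiplier (fun ν => (ν : ℂ) * (σ : ℂ) ^ (2 * ν) + (-(j : ℂ)) * (σ : ℂ) ^ (2 * ν))
        ((2 + i) / (1 - σ)) := by
      refine ((isMultiplier_mul_sq_pow h0 h1).add
        ((isMultiplier_sq_pow h0 h1).const_mul (-(j : ℂ)))).mono ?_
      have hji : (j : ℝ) + 1 ≤ i := by exact_mod_cast hj
      rw [norm_neg, Complex.norm_natCast, div_add' _ _ _ (by positivity),
        div_le_div_iff₀ (by positivity) h1']
      have : (0 : ℝ) ≤ j := j.cast_nonneg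
      nlinarith [mul_nonneg this h0, mul_nonneg h1'.le h0, mul_nonneg this h1'.le]
    have := hlin.mul (ih (by omega))
    rw [pow_succ', mul_assoc]
    convert this using 2 with ν
    rcases le_or_gt j ν with h | h
    · rw [Nat.descFactorial_succ]
      push_cast [h]
      ring
    · rw [Nat.descFactorial_eq_zero_iff_lt.2 h,
        Nat.descFactorial_eq_zero_iff_lt.2 (h.trans (Nat.lt_succ_self j))]
      simp

/-! ### Bernstein inequality for the Taylor–Abel–Poisson means -/

/-- For ν < r the sum is the full binomial expansion of ((1 - ϱ) + ϱ)^ν = 1, so the case distinction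
is superfluous. -/
theorem tapCoeff_eq_sum (r : ℕ) {ϱ : ℝ} (ν : ℕ) :
    tapCoeff r ϱ ν = ∑ j ∈ Finset.range r, (ν.choose j : ℝ) * (1 - ϱ) ^ j * ϱ ^ (ν - j) := by
  rw [tapCoeff]
  split_ifs with h
  · have h1 : ((1 - ϱ) + ϱ) ^ ν = 1 := by simp
    refine h1.symm.trans ?_
    rw [add_pow]
    refine (Finset.sum_subset (Finset.range_subset_range.2 h) fun j _ hj => ?_).trans
      (Finset.sum_congr rfl fun j _ => by ring)
    rw [Nat.choose_eq_zero_of_lt (by simpa using hj)]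
    simp
  · rfl

/-- Write ϱ = σ^(2N) with N = a + b + j + 1. Then ϱ^ν supplies one σ^(2ν) for each of the a + b + j
linear factors, including those of the binomial coefficient, and one more for the base multiplier.
Each linear factor costs a multiple of (1 - ϱ)⁻¹, and (1 - ϱ)^j pays for j of them. The shift from
ϱ^ν to ϱ^(ν-j) costs at most 2^j because ϱ ≥ 1/2. -/
theorem isMultiplier_tap_term (a b j : ℕ) : ∃ K : ℝ, ∀ ϱ : ℝ, 1 / 2 ≤ ϱ → ϱ < 1 →
    IsMultiplier (fun ν => (ν.descFactorial a : ℂ) * (ν.descFactorial b : ℂ) *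
      ((ν.choose j : ℝ) * (1 - ϱ) ^ j * ϱ ^ (ν - j) : ℝ)) (K * ((1 - ϱ) ^ (a + b))⁻¹) := by
  set N : ℕ := a + b + j + 1 with hN
  refine ⟨((2 + a) * (2 * N)) ^ a * ((2 + b) * (2 * N)) ^ b * ((2 + j) * (2 * N)) ^ j * 2 ^ j,
    fun ϱ hϱ hϱ1 => ?_⟩
  have hϱ0 : 0 < ϱ := by linarith
  have h1ϱ : 0 < 1 - ϱ := by linarith
  set σ : ℝ := ϱ ^ ((2 * N : ℕ) : ℝ)⁻¹ with hσ
  have hσN : σ ^ (2 * N) = ϱ := Real.rpow_inv_natCast_pow hϱ0.le (by omega)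
  have h0 : 0 ≤ σ := Real.rpow_nonneg hϱ0.le _
  have h1 : σ < 1 := Real.rpow_lt_one hϱ0.le hϱ1 (by positivity)
  have h1σ : 0 < 1 - σ := by linarith
  -- Bernoulli's inequality: ϱ = σ^(2N) ≥ 1 - 2N(1 - σ).
  have hinv : (1 - σ)⁻¹ ≤ 2 * N / (1 - ϱ) := by
    rw [inv_eq_one_div, div_le_div_iff₀ h1σ h1ϱ]
    have := one_add_mul_le_pow (a := σ - 1) (by linarith) (2 * N)
    rw [add_sub_cancel, hσN] at this
    push_cast at this
    linarith
  have key := (isMultiplier_descFactorial_mul h0 h1 (isMultiplier_descFactorial_mul h0 h1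
    (isMultiplier_descFactorial_mul h0 h1 (isMultiplier_sq_pow h0 h1) j) b) a).const_mul
    (((1 - ϱ) ^ j * (ϱ ^ j)⁻¹ * (j ! : ℝ)⁻¹ : ℝ) : ℂ)
  have hle : ‖(((1 - ϱ) ^ j * (ϱ ^ j)⁻¹ * (j ! : ℝ)⁻¹ : ℝ) : ℂ)‖ ≤ (1 - ϱ) ^ j * 2 ^ j := by
    rw [Complex.norm_of_nonneg (by positivity), mul_assoc]
    gcongr
    rw [← mul_one ((2 : ℝ) ^ j)]
    gcongr
    · rw [← inv_pow]
      gcongr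
      rw [inv_le_comm₀ hϱ0 two_pos]
      linarith
    · exact inv_le_one_of_one_le₀ (by exact_mod_cast j.factorial_pos)
  have hdiv (i : ℕ) : ((2 + (i : ℝ)) / (1 - σ)) ^ i ≤
      ((2 + i) * (2 * N)) ^ i * ((1 - ϱ) ^ i)⁻¹ := by
    have : (2 + (i : ℝ)) / (1 - σ) ≤ (2 + i) * (2 * N) * (1 - ϱ)⁻¹ := by
      rw [div_eq_mul_inv, mul_assoc, ← div_eq_mul_inv (2 * (N : ℝ))]
      gcongr
    rw [← inv_pow, ← mul_pow]
    gcongr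
  have hbound : ‖(((1 - ϱ) ^ j * (ϱ ^ j)⁻¹ * (j ! : ℝ)⁻¹ : ℝ) : ℂ)‖ *
      (((2 + (a : ℝ)) / (1 - σ)) ^ a * (((2 + (b : ℝ)) / (1 - σ)) ^ b *
        (((2 + (j : ℝ)) / (1 - σ)) ^ j * 1))) ≤
      ((2 + a) * (2 * N)) ^ a * ((2 + b) * (2 * N)) ^ b * ((2 + j) * (2 * N)) ^ j * 2 ^ j *
        ((1 - ϱ) ^ (a + b))⁻¹ := by
    refine (mul_le_mul hle (mul_le_mul (hdiv a) (mul_le_mul (hdiv b) (mul_le_mul_of_nonneg_right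
      (hdiv j) zero_le_one) (by positivity) (by positivity)) (by positivity) (by positivity))
        (by positivity) (by positivity)).trans (le_of_eq ?_)
    rw [pow_add]
    field_simp
  have key' := key.mono hbound
  refine (congrArg (fun m => IsMultiplier m _) (funext fun ν => ?_)).mp key'
  rcases lt_or_ge ν j with h | h
  · rw [Nat.choose_eq_zero_of_lt h, Nat.descFactorial_eq_zero_iff_lt.2 h]
    simp
  · have hpow : (ϱ : ℂ) ^ ν = (ϱ : ℂ) ^ j * (ϱ : ℂ) ^ (ν - j) := by
      rw [← pow_add, Nat.add_sub_cancel' h]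
    have hσν : (σ : ℂ) ^ (2 * a * ν) * ((σ : ℂ) ^ (2 * b * ν) * ((σ : ℂ) ^ (2 * j * ν) *
        (σ : ℂ) ^ (2 * ν))) = (ϱ : ℂ) ^ ν := by
      rw [← hσN, ← pow_add, ← pow_add, ← pow_add]
      push_cast
      rw [← pow_mul]
      congr 1
      rw [hN]
      ring
    have hj : (j ! : ℂ) ≠ 0 := by exact_mod_cast j.factorial_ne_zero
    have hϱc : (ϱ : ℂ) ^ j ≠ 0 := pow_ne_zero _ (by exact_mod_cast hϱ0.ne')
    have hd : (ν.descFactorial j : ℂ) = j ! * ν.choose j := by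
      exact_mod_cast Nat.descFactorial_eq_factorial_mul_choose ν j
    calc _ = (ν.descFactorial a : ℂ) * (ν.descFactorial b : ℂ) * (ν.descFactorial j : ℂ) *
          ((1 - ϱ) ^ j * ((ϱ : ℂ) ^ j)⁻¹ * (j ! : ℂ)⁻¹) *
          ((σ : ℂ) ^ (2 * a * ν) * ((σ : ℂ) ^ (2 * b * ν) * ((σ : ℂ) ^ (2 * j * ν) *
        (σ : ℂ) ^ (2 * ν)))) := by push_cast; ring
      _ = _ := by
        rw [hσν, hpow, hd]
        push_cast
        field_simp

theorem isMultiplier_tap (a b r : ℕ) : ∃ K : ℝ, ∀ ϱ : ℝ, 1 / 2 ≤ ϱ → ϱ < 1 →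
    IsMultiplier (fun ν => (ν.descFactorial a : ℂ) * (ν.descFactorial b : ℂ) *
      (tapCoeff r ϱ ν : ℂ)) (K * ((1 - ϱ) ^ (a + b))⁻¹) := by
  choose K hK using isMultiplier_tap_term a b
  refine ⟨∑ j ∈ Finset.range r, K j, fun ϱ h0 h1 => ?_⟩
  have := IsMultiplier.sum (Finset.range r) fun j _ => hK j ϱ h0 h1
  simp only [tapCoeff_eq_sum, Complex.ofReal_sum, Finset.mul_sum, Finset.sum_mul]
  exact this

theorem tendsto_tapCoeff {r : ℕ} (hr : 1 ≤ r) (ν : ℕ) :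
    Tendsto (fun ϱ : ℝ => tapCoeff r ϱ ν) (𝓝 1) (𝓝 1) := by
  have hc : Continuous fun ϱ : ℝ => tapCoeff r ϱ ν := by
    simp only [tapCoeff_eq_sum]
    fun_prop
  have h1 : tapCoeff r 1 ν = 1 := by
    rw [tapCoeff_eq_sum, Finset.sum_eq_single_of_mem 0 (Finset.mem_range.2 hr)]
    · simp
    · intro j _ hj
      simp [hj]
  simpa only [h1] using hc.tendsto 1

/-! ### Dyadic forms of the conditions 𝒵 and 𝒵_n -/

section Majorant

variable {ω : ℝ → ℝ}

theorem half_pow_mem (k : ℕ) : (1 / 2 : ℝ) ^ k ∈ Set.Icc (0 : ℝ) 1 :=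
  ⟨by positivity, pow_le_one₀ (by norm_num) (by norm_num)⟩

theorem IsMajorant.pos (h : IsMajorant ω) {t : ℝ} (h0 : 0 < t) (h1 : t ≤ 1) : 0 < ω t := by
  have := h.strictMonoOn (by simp) ⟨h0.le, h1⟩ h0
  rwa [h.map_zero] at this

theorem IsMajorant.mono (h : IsMajorant ω) {s t : ℝ} (h0 : 0 ≤ s) (hst : s ≤ t) (h1 : t ≤ 1) :
    ω s ≤ ω t :=
  h.strictMonoOn.monotoneOn ⟨h0, hst.trans h1⟩ ⟨h0.trans hst, h1⟩ hst

theorem IsMajorant.tendsto_half_pow (h : IsMajorant ω) :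
    Tendsto (fun N : ℕ => ω ((1 / 2) ^ N)) atTop (𝓝 0) := by
  have h0 := h.continuousOn 0 (by simp)
  rw [ContinuousWithinAt, h.map_zero] at h0
  refine h0.comp (tendsto_nhdsWithin_iff.2 ⟨?_, Eventually.of_forall half_pow_mem⟩)
  exact tendsto_pow_atTop_nhds_zero_of_lt_one (by norm_num) (by norm_num)

theorem IsMajorant.intervalIntegrable (h : IsMajorant ω) (n : ℕ) {a b : ℝ} (ha : 0 < a)
    (hab : a ≤ b) (hb : b ≤ 1) :
    IntervalIntegrable (fun t => ω t / t ^ (n + 1)) volume a b := by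
  refine ContinuousOn.intervalIntegrable ?_
  rw [Set.uIcc_of_le hab]
  refine (h.continuousOn.mono (Set.Icc_subset_Icc ha.le hb)).div (by fun_prop) fun t ht => ?_
  exact pow_ne_zero _ (ha.trans_le ht.1).ne'

/-- On each dyadic interval, bound ω below by its value at the left end and t^(n+1) above by its
value at the right end. The interval length and the change of endpoint account for 2^(n+1). -/
theorem IsMajorant.sum_le_integral (h : IsMajorant ω) (n N M : ℕ) :
    ∑ k ∈ Finset.range M, ω ((1 / 2) ^ (N + k + 1)) * 2 ^ ((N + k + 1) * n) ≤
      2 ^ (n + 1) * ∫ t in (1 / 2 : ℝ) ^ (N + M)..(1 / 2 : ℝ) ^ N, ω t / t ^ (n + 1) := by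
  have hpos (k : ℕ) : (0 : ℝ) < (1 / 2) ^ k := by positivity
  have hle {k l : ℕ} (hkl : k ≤ l) : (1 / 2 : ℝ) ^ l ≤ (1 / 2) ^ k :=
    pow_le_pow_of_le_one (by norm_num) (by norm_num) hkl
  have hint {k l : ℕ} (hkl : k ≤ l) := h.intervalIntegrable n (hpos l) (hle hkl) (half_pow_mem k).2
  induction M with
  | zero => simp
  | succ M ih =>
    rw [Finset.sum_range_succ, ← intervalIntegral.integral_add_adjacent_intervals
      (hint (show N + M ≤ N + (M + 1) by omega)) (hint (show N ≤ N + M by omega)), mul_add, add_comm]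
    refine add_le_add ?_ ih
    set j := N + M
    have hstep : ω ((1 / 2) ^ (j + 1)) / ((1 / 2) ^ j) ^ (n + 1) * ((1 / 2) ^ j - (1 / 2) ^ (j + 1))
        ≤ ∫ t in (1 / 2 : ℝ) ^ (j + 1)..(1 / 2 : ℝ) ^ j, ω t / t ^ (n + 1) := by
      have hc : ∫ _ in (1 / 2 : ℝ) ^ (j + 1)..(1 / 2 : ℝ) ^ j,
          ω ((1 / 2) ^ (j + 1)) / ((1 / 2) ^ j) ^ (n + 1) =
          ω ((1 / 2) ^ (j + 1)) / ((1 / 2) ^ j) ^ (n + 1) *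
            ((1 / 2) ^ j - (1 / 2) ^ (j + 1)) := by
        rw [intervalIntegral.integral_const, smul_eq_mul, mul_comm]
      rw [← hc]
      refine intervalIntegral.integral_mono_on (hle (by omega)) (by simp) (hint (by omega))
        fun t ht => ?_
      have ht0 : 0 < t := (hpos _).trans_le ht.1
      have ht1 : t ≤ 1 := ht.2.trans (half_pow_mem j).2
      have := (h.pos ht0 ht1).le
      gcongr
      · exact h.mono (hpos _).le ht.1 ht1
      · exact ht.2
    refine le_trans (le_of_eq ?_) (mul_le_mul_of_nonneg_left hstep (by positivity))
    have e1 : (1 / 2 : ℝ) ^ j - (1 / 2) ^ (j + 1) = (1 / 2) ^ (j + 1) := by ring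
    rw [e1]
    simp only [one_div, inv_pow]
    field_simp
    ring

theorem ClassZ.sum_le (h : ClassZ ω) : ∃ C : ℝ, 0 ≤ C ∧ ∀ᶠ N : ℕ in atTop, ∀ M : ℕ,
    ∑ k ∈ Finset.range M, ω ((1 / 2) ^ (N + k + 1)) ≤ C * ω ((1 / 2) ^ N) := by
  obtain ⟨C, hC0, hC⟩ := h.isBigO.exists_pos
  have hlim : Tendsto (fun N : ℕ => (1 / 2 : ℝ) ^ N) atTop (𝓝[>] 0) :=
    tendsto_nhdsWithin_iff.2 ⟨tendsto_pow_atTop_nhds_zero_of_lt_one (by norm_num) (by norm_num),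
      Eventually.of_forall fun N => by simp⟩
  refine ⟨2 * C, by positivity, (hlim.eventually hC.bound).mono fun N hN M => ?_⟩
  have hm := h.toIsMajorant
  have h1 := hm.sum_le_integral 0 N M
  simp only [mul_zero, pow_zero, mul_one, zero_add, pow_one] at h1
  have hω := hm.pos (t := (1 / 2) ^ N) (by positivity) (half_pow_mem N).2
  rw [Real.norm_of_nonneg hω.le] at hN
  have hle : (1 / 2 : ℝ) ^ (N + M) ≤ (1 / 2) ^ N :=
    pow_le_pow_of_le_one (by norm_num) (by norm_num) (by omega)
  have hi : IntervalIntegrable (fun t => ω t / t) volume 0 ((1 / 2) ^ N) := by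
    refine h.integrable.mono_set ?_
    rw [Set.uIcc_of_le (by positivity), Set.uIcc_of_le zero_le_one]
    exact Set.Icc_subset_Icc_right (half_pow_mem N).2
  have h2 : ∫ t in (1 / 2 : ℝ) ^ (N + M)..(1 / 2 : ℝ) ^ N, ω t / t ≤
      ∫ t in (0 : ℝ)..(1 / 2 : ℝ) ^ N, ω t / t := by
    refine intervalIntegral.integral_mono_interval (by positivity) hle le_rfl ?_ hi
    filter_upwards [ae_restrict_mem measurableSet_Ioc] with t ht
    exact div_nonneg (hm.pos ht.1 (ht.2.trans (half_pow_mem N).2)).le ht.1.le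
  have h3 := (le_abs_self _).trans hN
  linarith

/-- The summand 1 makes room for the initial norm in `exists_growth_bound`. It and the term k = 0,
which the integral over (2^(-N), 1) does not control, are absorbed because the right-hand side is
bounded below by a multiple of the fixed positive term k = 1. -/
theorem ClassZn.sum_le {n : ℕ} (h : ClassZn n ω) : ∃ C : ℝ, 0 ≤ C ∧ ∀ᶠ N : ℕ in atTop,
    1 + ∑ k ∈ Finset.range N, ω ((1 / 2) ^ k) * 2 ^ (k * n) ≤
      C * (ω ((1 / 2) ^ N) * 2 ^ (N * n)) := by
  obtain ⟨C, hC0, hC⟩ := h.isBigO.exists_pos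
  have hlim : Tendsto (fun N : ℕ => (1 / 2 : ℝ) ^ N) atTop (𝓝[>] 0) :=
    tendsto_nhdsWithin_iff.2 ⟨tendsto_pow_atTop_nhds_zero_of_lt_one (by norm_num) (by norm_num),
      Eventually.of_forall fun N => by simp⟩
  have hm := h.toIsMajorant
  have hpos (k : ℕ) : 0 < ω ((1 / 2) ^ k) := hm.pos (by positivity) (half_pow_mem k).2
  set L := ω ((1 / 2) ^ 1) * 2 ^ (1 * n) with hL
  have hL0 : 0 < L := mul_pos (hpos 1) (by positivity)
  have hω1 := hpos 0
  set D := 2 ^ (n + 1) * C with hD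
  refine ⟨(1 + ω ((1 / 2) ^ 0)) / L * D + D, by positivity, ?_⟩
  filter_upwards [hlim.eventually hC.bound, eventually_ge_atTop 1] with N hN hN1
  have h1 := hm.sum_le_integral n 0 N
  simp only [zero_add, pow_zero] at h1
  have hdiv : ω ((1 / 2) ^ N) / ((1 / 2) ^ N) ^ n = ω ((1 / 2) ^ N) * 2 ^ (N * n) := by
    rw [← pow_mul, div_eq_mul_inv]
    congr 1
    rw [one_div, inv_pow, inv_inv]
  rw [hdiv, Real.norm_of_nonneg (mul_pos (hpos N) (by positivity)).le] at hN
  have h2 : ∑ k ∈ Finset.range N, ω ((1 / 2) ^ (k + 1)) * 2 ^ ((k + 1) * n) ≤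
      D * (ω ((1 / 2) ^ N) * 2 ^ (N * n)) := by
    refine h1.trans ?_
    rw [hD, mul_assoc]
    gcongr
    exact (le_abs_self _).trans hN
  have h3 : L ≤ D * (ω ((1 / 2) ^ N) * 2 ^ (N * n)) := by
    refine le_trans ?_ h2
    exact Finset.single_le_sum (f := fun k => ω ((1 / 2) ^ (k + 1)) * 2 ^ ((k + 1) * n))
      (fun k _ => (mul_pos (hpos _) (by positivity)).le) (Finset.mem_range.2 hN1)
  have h4 : ∑ k ∈ Finset.range N, ω ((1 / 2) ^ k) * 2 ^ (k * n) ≤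
      ω ((1 / 2) ^ 0) + ∑ k ∈ Finset.range N, ω ((1 / 2) ^ (k + 1)) * 2 ^ ((k + 1) * n) := by
    have h5 := Finset.sum_range_succ' (fun k => ω ((1 / 2) ^ k) * 2 ^ (k * n)) N
    rw [Finset.sum_range_succ] at h5
    have h6 := (mul_pos (hpos N) (show (0 : ℝ) < 2 ^ (N * n) by positivity))
    simp only [zero_mul, pow_zero, mul_one] at h5 ⊢
    linarith
  have h7 : 1 + ω ((1 / 2) ^ 0) ≤ (1 + ω ((1 / 2) ^ 0)) / L *
      (D * (ω ((1 / 2) ^ N) * 2 ^ (N * n))) := by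
    calc 1 + ω ((1 / 2) ^ 0) = (1 + ω ((1 / 2) ^ 0)) / L * L := by field_simp
      _ ≤ _ := by gcongr
  rw [add_mul, mul_assoc]
  linarith

end Majorant

/-! ### Telescoping in a normed group -/

section Sequences

variable {E : Type*} [NormedAddCommGroup E] {x : ℕ → E} {u : ℕ → ℝ} {K C : ℝ}

theorem exists_limit_of_tail_bound [CompleteSpace E] (hK : 0 ≤ K) (hC : 0 ≤ C)
    (hu : ∀ k, 0 ≤ u k) (hlim : Tendsto u atTop (𝓝 0))
    (hx : ∀ᶠ k in atTop, ‖x (k + 1) - x k‖ ≤ K * u k)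
    (hsum : ∀ᶠ N in atTop, ∀ M, ∑ k ∈ Finset.range M, u (N + k + 1) ≤ C * u N) :
    ∃ y : E, Tendsto x atTop (𝓝 y) ∧ ∀ᶠ N in atTop, ‖y - x N‖ ≤ K * (1 + C) * u N := by
  obtain ⟨N₀, h⟩ := eventually_atTop.1 (hx.and hsum)
  have hstep (N : ℕ) (hN : N₀ ≤ N) (M : ℕ) :
      ‖x (N + M + 1) - x N‖ ≤ K * (u N + ∑ k ∈ Finset.range M, u (N + k + 1)) := by
    induction M with
    | zero => simpa using (h N hN).1
    | succ M ih =>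
      rw [Finset.sum_range_succ, ← add_assoc (u N), mul_add K (_ + _),
        ← sub_add_sub_cancel _ (x (N + M + 1)), add_comm]
      exact (norm_add_le _ _).trans (add_le_add ih (h (N + M + 1) (by omega)).1)
  have hb (N : ℕ) (hN : N₀ ≤ N) (M : ℕ) (hM : N ≤ M) : ‖x M - x N‖ ≤ K * (1 + C) * u N := by
    have hpos := hu N
    obtain ⟨j, rfl⟩ := Nat.exists_eq_add_of_le hM
    cases j with
    | zero => simp only [add_zero, sub_self, norm_zero]; positivity
    | succ j =>
      refine (hstep N hN j).trans ?_
      rw [mul_assoc]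
      gcongr
      have := (h N hN).2 j
      linarith
  have hcauchy : CauchySeq fun k => x (k + N₀) := by
    refine cauchySeq_of_le_tendsto_0' (fun k => K * (1 + C) * u (k + N₀)) (fun k l hkl => ?_) ?_
    · rw [dist_comm, dist_eq_norm]
      exact hb _ (by omega) _ (by omega)
    · simpa using ((tendsto_add_atTop_iff_nat N₀).2 hlim).const_mul (K * (1 + C))
  obtain ⟨y, hy⟩ := cauchySeq_tendsto_of_complete hcauchy
  have hy' := (tendsto_add_atTop_iff_nat N₀).1 hy
  refine ⟨y, hy', eventually_atTop.2 ⟨N₀, fun N hN => ?_⟩⟩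
  exact le_of_tendsto ((hy'.sub_const (x N)).norm) (eventually_atTop.2 ⟨N, hb N hN⟩)

theorem exists_growth_bound (hK : 0 ≤ K) (hu : ∀ k, 0 ≤ u k)
    (hx : ∀ᶠ k in atTop, ‖x (k + 1) - x k‖ ≤ K * u k)
    (hsum : ∀ᶠ N in atTop, 1 + ∑ k ∈ Finset.range N, u k ≤ C * u N) :
    ∃ B : ℝ, 0 ≤ B ∧ ∀ᶠ N in atTop, ‖x N‖ ≤ B * (C * u N) := by
  obtain ⟨N₀, h⟩ := eventually_atTop.1 hx
  refine ⟨‖x N₀‖ + K, by positivity, ?_⟩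
  filter_upwards [hsum, eventually_ge_atTop N₀] with N hN hN0
  have hle : ‖x N‖ ≤ ‖x N₀‖ + K * ∑ k ∈ Finset.range N, u k := by
    clear hN
    induction N, hN0 using Nat.le_induction with
    | base =>
      have : 0 ≤ ∑ k ∈ Finset.range N₀, u k := Finset.sum_nonneg fun k _ => hu k
      exact le_add_of_nonneg_right (mul_nonneg hK this)
    | succ N hN0 ih =>
      rw [Finset.sum_range_succ, mul_add, ← add_assoc, ← add_sub_cancel (x N) (x (N + 1))]
      exact (norm_add_le _ _).trans (add_le_add ih (h N hN0))
  have hS : 0 ≤ ∑ k ∈ Finset.range N, u k := Finset.sum_nonneg fun k _ => hu k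
  calc ‖x N‖ ≤ (‖x N₀‖ + K) * (1 + ∑ k ∈ Finset.range N, u k) := by
        nlinarith [mul_nonneg (norm_nonneg (x N₀)) hS]
    _ ≤ _ := by gcongr

end Sequences

/-! ### Dyadic differences of the means and their derivatives -/

/-- Both sides agree because the cross terms d l l' cancel by commutativity. The right side involves
only approximation errors, to which Bernstein applies; the symbol d alone need not be summable. -/
theorem radialMul_sub_radialMul {d l l' : ℕ → ℂ} (hl : ShellSummable l) (hl' : ShellSummable l')
    (hd : ShellSummable fun ν => d ν * l ν) (hd' : ShellSummable fun ν => d ν * l' ν)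
    {f : (Fin 3 → ℝ) → ℂ} (hf : Integrable f hexMeasure) :
    radialMul (fun ν => d ν * l' ν) f - radialMul (fun ν => d ν * l ν) f =
      radialMul (fun ν => d ν * l' ν) (f - radialMul l f) -
        radialMul (fun ν => d ν * l ν) (f - radialMul l' f) := by
  rw [radialMul_sub hd' hf (hl.integrable_radialMul f),
    radialMul_sub hd hf (hl'.integrable_radialMul f), radialMul_radialMul hl,
    radialMul_radialMul hl']
  have : (fun ν => d ν * l' ν * l ν) = fun ν => d ν * l ν * l' ν := by
    funext ν; ring
  rw [this]
  abel

/-- The multiplier of the derivatives of orders `a` and `b` of the Taylor-Abel-Poisson mean with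
parameter `1 - 2 ^ (-N)`. -/
noncomputable def dyadicMul (r a b N : ℕ) (ν : ℕ) : ℂ :=
  (ν.descFactorial a : ℂ) * (ν.descFactorial b : ℂ) * (tapCoeff r (1 - (1 / 2) ^ N) ν : ℂ)

theorem exists_isMultiplier_dyadicMul (r a b : ℕ) : ∃ K : ℝ, 0 ≤ K ∧ ∀ N : ℕ, 1 ≤ N →
    IsMultiplier (dyadicMul r a b N) (K * 2 ^ (N * (a + b))) := by
  obtain ⟨K, hK⟩ := isMultiplier_tap a b r
  refine ⟨|K|, abs_nonneg K, fun N hN => ?_⟩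
  have h1 : (1 / 2 : ℝ) ^ N ≤ 1 / 2 :=
    pow_le_of_le_one (by norm_num) (by norm_num) (by omega)
  have h2 : (0 : ℝ) < (1 / 2) ^ N := by positivity
  refine (hK (1 - (1 / 2) ^ N) (by linarith) (by linarith)).mono ?_
  rw [sub_sub_cancel, one_div, inv_pow, inv_pow, inv_inv, ← pow_mul]
  gcongr
  exact le_abs_self K

theorem shellSummable_dyadicMul (r a b : ℕ) {N : ℕ} (hN : 1 ≤ N) :
    ShellSummable (dyadicMul r a b N) := by
  obtain ⟨K, -, hK⟩ := exists_isMultiplier_dyadicMul r a b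
  exact (hK N hN).summable

theorem tap_eq_radialMul (r N : ℕ) (f : (Fin 3 → ℝ) → ℂ) :
    tap r (1 - (1 / 2) ^ N) f = radialMul (dyadicMul r 0 0 N) f := by
  funext t
  simp [tap, radialMul, dyadicMul]

/-- The Bernstein loss 2^(N(m+b)) meets the approximation rate 2^(-Nm) u_N, leaving 2^(Nb) u_N. -/
theorem eLpNorm_dyadic_sub_le {r m : ℕ} (b : ℕ) {p : ℝ≥0∞} (hp : 1 ≤ p) {f : (Fin 3 → ℝ) → ℂ}
    (hf : MemLp f p hexMeasure) {u : ℕ → ℝ} (hu : ∀ k, 0 ≤ u k) (hmono : ∀ k, u (k + 1) ≤ u k)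
    {C : ℝ} (hA : ∀ᶠ N : ℕ in atTop, eLpNorm (f - tap r (1 - (1 / 2) ^ N) f) p hexMeasure ≤
      ENNReal.ofReal (C * ((1 / 2) ^ (N * m) * u N))) :
    ∃ K : ℝ, 0 ≤ K ∧ ∀ᶠ N : ℕ in atTop,
      eLpNorm (radialMul (dyadicMul r m b (N + 1)) f - radialMul (dyadicMul r m b N) f) p
        hexMeasure ≤ ENNReal.ofReal (K * (u N * 2 ^ (N * b))) := by
  obtain ⟨K, hK0, hK⟩ := exists_isMultiplier_dyadicMul r m b
  -- The 2 counts the two error terms, 2^(m+b) compares levels N + 1 and N, and |C| appears because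
  -- C may be negative.
  refine ⟨2 * (K * 2 ^ (m + b) * |C|), by positivity, ?_⟩
  filter_upwards [hA, (tendsto_add_atTop_nat 1).eventually hA, eventually_ge_atTop 1]
    with N h1 h2 hN
  have hl := shellSummable_dyadicMul r 0 0 hN
  have hl' := shellSummable_dyadicMul r 0 0 (N := N + 1) (by omega)
  have hM := hK N hN
  have hM' := hK (N + 1) (by omega)
  have hu0 := hu N
  have hid : ∀ N, dyadicMul r m b N = fun ν => ((ν.descFactorial m : ℂ) * (ν.descFactorial b : ℂ)) *
      dyadicMul r 0 0 N ν := by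
    intro N; funext ν; simp [dyadicMul]
  have hsub := radialMul_sub_radialMul (d := fun ν => (ν.descFactorial m : ℂ) *
    (ν.descFactorial b : ℂ)) hl hl' (by rw [← hid]; exact hM.summable)
    (by rw [← hid]; exact hM'.summable) (hf.integrable hp)
  simp only [← hid, ← tap_eq_radialMul] at hsub
  have hmem (N : ℕ) (hN : 1 ≤ N) : MemLp (f - tap r (1 - (1 / 2) ^ N) f) p hexMeasure := by
    rw [tap_eq_radialMul]
    exact hf.sub ((shellSummable_dyadicMul r 0 0 hN).memLp_radialMul f p)
  have hcancel (j : ℕ) : (1 / 2 : ℝ) ^ j * 2 ^ j = 1 := by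
    rw [← mul_pow]; norm_num
  have hb1 : eLpNorm (radialMul (dyadicMul r m b (N + 1)) (f - tap r (1 - (1 / 2) ^ N) f)) p
      hexMeasure ≤ ENNReal.ofReal (K * 2 ^ (m + b) * |C| * (u N * 2 ^ (N * b))) := by
    refine (hM'.bound hp (hmem N hN)).trans ((mul_le_mul_right h1 _).trans ?_)
    rw [← ENNReal.ofReal_mul hM'.nonneg]
    refine ENNReal.ofReal_le_ofReal ?_
    calc K * 2 ^ ((N + 1) * (m + b)) * (C * ((1 / 2) ^ (N * m) * u N))
        ≤ K * 2 ^ ((N + 1) * (m + b)) * (|C| * ((1 / 2) ^ (N * m) * u N)) := by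
          gcongr; exact le_abs_self C
      _ = K * 2 ^ (m + b) * |C| * (u N * 2 ^ (N * b)) * ((1 / 2) ^ (N * m) * 2 ^ (N * m)) := by
          ring
      _ = _ := by rw [hcancel, mul_one]
  have hb2 : eLpNorm (radialMul (dyadicMul r m b N) (f - tap r (1 - (1 / 2) ^ (N + 1)) f)) p
      hexMeasure ≤ ENNReal.ofReal (K * 2 ^ (m + b) * |C| * (u N * 2 ^ (N * b))) := by
    refine (hM.bound hp (hmem (N + 1) (by omega))).trans ((mul_le_mul_right h2 _).trans ?_)
    rw [← ENNReal.ofReal_mul hM.nonneg]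
    refine ENNReal.ofReal_le_ofReal ?_
    calc K * 2 ^ (N * (m + b)) * (C * ((1 / 2) ^ ((N + 1) * m) * u (N + 1)))
        ≤ K * 2 ^ (N * (m + b)) * (|C| * ((1 / 2) ^ (N * m) * u N)) := by
          have h3 : (1 / 2 : ℝ) ^ ((N + 1) * m) ≤ (1 / 2) ^ (N * m) :=
            pow_le_pow_of_le_one (by norm_num) (by norm_num)
              (Nat.mul_le_mul_right m (Nat.le_succ N))
          have := hu (N + 1)
          gcongr
          · exact le_abs_self C
          · exact hmono N
      _ = K * |C| * (u N * 2 ^ (N * b)) * ((1 / 2) ^ (N * m) * 2 ^ (N * m)) := by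
          ring
      _ ≤ K * 2 ^ (m + b) * |C| * (u N * 2 ^ (N * b)) := by
          rw [hcancel, mul_one]
          gcongr
          exact le_mul_of_one_le_right hK0 (one_le_pow₀ (by norm_num))
  rw [hsub]
  refine (eLpNorm_sub_le (hM'.summable.continuous_radialMul _).aestronglyMeasurable
    (hM.summable.continuous_radialMul _).aestronglyMeasurable hp).trans
    ((add_le_add hb1 hb2).trans (le_of_eq ?_))
  rw [← ENNReal.ofReal_add (by positivity) (by positivity)]
  congr 1
  ring

/-- On a probability space a coefficient is bounded by the L₁ norm, hence by the L_p norm. -/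
theorem tendsto_coeff_of_tendsto_Lp {p : ℝ≥0∞} [Fact (1 ≤ p)] {x : ℕ → Lp ℂ p hexMeasure}
    {y : Lp ℂ p hexMeasure} (h : Tendsto x atTop (𝓝 y)) (k : Fin 3 → ℤ) :
    Tendsto (fun N => coeff (x N) k) atTop (𝓝 (coeff y k)) := by
  rw [tendsto_iff_norm_sub_tendsto_zero] at h ⊢
  refine squeeze_zero (fun _ => norm_nonneg _) (fun N => ?_) h
  have hi (z : Lp ℂ p hexMeasure) : Integrable z hexMeasure := (Lp.memLp z).integrable Fact.out
  rw [← coeff_sub (hi _) (hi _)]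
  refine (norm_coeff_le _ k).trans ?_
  rw [integral_norm_eq_lintegral_enorm ((hi _).sub (hi _)).1, ← eLpNorm_one_eq_lintegral_enorm,
    Lp.norm_def, eLpNorm_congr_ae (Lp.coeFn_sub (x N) y)]
  refine ENNReal.toReal_mono ((Lp.memLp (x N)).sub (Lp.memLp y)).eLpNorm_ne_top ?_
  exact eLpNorm_le_eLpNorm_of_exponent_le Fact.out ((hi _).sub (hi _)).1

theorem coeff_congr_ae {f g : (Fin 3 → ℝ) → ℂ} (h : f =ᵐ[hexMeasure] g) (k : Fin 3 → ℤ) :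
    coeff f k = coeff g k :=
  integral_congr_ae (h.mono fun t ht => by simp only [ht])

theorem descFactorial_eq_ite (ν n : ℕ) : (ν.descFactorial n : ℂ) =
    if ν < n then 0 else (ν ! : ℂ) / ((ν - n)! : ℂ) := by
  split_ifs with h
  · rw [Nat.descFactorial_eq_zero_iff_lt.2 h, Nat.cast_zero]
  · rw [eq_div_iff (by exact_mod_cast (ν - n).factorial_ne_zero), mul_comm]
    exact_mod_cast Nat.factorial_mul_descFactorial (not_lt.1 h)

theorem isRadialDeriv_of_coeff {n : ℕ} {f g : (Fin 3 → ℝ) → ℂ} (hf : Integrable f hexMeasure)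
    (hg : Integrable g hexMeasure) (h : ∀ k : Fin 3 → ℤ, k 0 + k 1 + k 2 = 0 →
      coeff g k = ((size k).descFactorial n : ℂ) * coeff f k) : IsRadialDeriv n f g := by
  refine ⟨hf, hg, fun k hk => ?_⟩
  rw [h k hk, descFactorial_eq_ite, ite_mul, zero_mul]

/-- Iterated radial derivatives multiply falling factorials of the same ν and do not combine into
order m + n; hence the two separate orders in `dyadicMul`. -/
theorem isRadialDeriv_dyadicMul (r m n : ℕ) {N : ℕ} (hN : 1 ≤ N) (f : (Fin 3 → ℝ) → ℂ) :
    IsRadialDeriv n (radialMul (dyadicMul r m 0 N) f) (radialMul (dyadicMul r m n N) f) := by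
  have h1 := shellSummable_dyadicMul r m 0 hN
  have h2 := shellSummable_dyadicMul r m n hN
  refine isRadialDeriv_of_coeff (h1.integrable_radialMul f) (h2.integrable_radialMul f)
    fun k hk => ?_
  rw [coeff_radialMul h1 f hk, coeff_radialMul h2 f hk]
  simp only [dyadicMul, Nat.descFactorial_zero, Nat.cast_one]
  ring

theorem tendsto_one_sub_half_pow :
    Tendsto (fun N : ℕ => 1 - (1 / 2 : ℝ) ^ N) atTop (𝓝[<] 1) := by
  refine tendsto_nhdsWithin_iff.2 ⟨?_, Eventually.of_forall fun N => by simp⟩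
  simpa using (tendsto_pow_atTop_nhds_zero_of_lt_one (r := (1 / 2 : ℝ)) (by norm_num)
    (by norm_num)).const_sub 1

end Hexagon

/-! ### The inverse theorem -/

theorem mainTheorem3 (p : ℝ≥0∞) (hp : 1 ≤ p) (n r : ℕ) (hn : 1 ≤ n) (hnr : n ≤ r)
    (ω : ℝ → ℝ) (hZ : Hexagon.ClassZ ω) (hZn : Hexagon.ClassZn n ω)
    (f : (Fin 3 → ℝ) → ℂ) (hf : MemLp f p Hexagon.hexMeasure)
    (hA : ∃ C : ℝ, ∀ᶠ ϱ : ℝ in 𝓝[<] 1,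
      eLpNorm (f - Hexagon.tap r ϱ f) p Hexagon.hexMeasure
        ≤ ENNReal.ofReal (C * ((1 - ϱ) ^ (r - n) * ω (1 - ϱ)))) :
    ∃ g : (Fin 3 → ℝ) → ℂ, Hexagon.IsRadialDeriv (r - n) f g ∧ MemLp g p Hexagon.hexMeasure ∧
      ∃ C : ℝ, ∀ᶠ δ : ℝ in 𝓝[>] 0,
        Hexagon.kFunctional n p δ g ≤ ENNReal.ofReal (C * ω δ) := by
  have : Fact (1 ≤ p) := ⟨hp⟩
  obtain ⟨C, hC⟩ := hA
  have hm := hZ.toIsMajorant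
  set m := r - n with hmdef
  set u : ℕ → ℝ := fun k => ω ((1 / 2) ^ k) with hu
  have hu0 (k : ℕ) : 0 ≤ u k := (hm.pos (by positivity) (Hexagon.half_pow_mem k).2).le
  have humono (k : ℕ) : u (k + 1) ≤ u k :=
    hm.mono (by positivity) (pow_le_pow_of_le_one (by norm_num) (by norm_num) (Nat.le_succ k))
      (Hexagon.half_pow_mem k).2
  have hA' : ∀ᶠ N : ℕ in atTop, eLpNorm (f - Hexagon.tap r (1 - (1 / 2) ^ N) f) p Hexagon.hexMeasure ≤
      ENNReal.ofReal (C * ((1 / 2) ^ (N * m) * u N)) := by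
    filter_upwards [Hexagon.tendsto_one_sub_half_pow.eventually hC] with N hN
    rwa [sub_sub_cancel, ← pow_mul] at hN
  have hmem (b N : ℕ) : MemLp (Hexagon.radialMul (Hexagon.dyadicMul r m b (N + 1)) f) p Hexagon.hexMeasure :=
    (Hexagon.shellSummable_dyadicMul r m b (by omega)).memLp_radialMul f p
  -- The index N + 1 keeps the parameter at least 1/2. The sequence b = 0 approximates f^{[m]}; b =
  -- n gives the n-th derivatives of its terms.
  let x (b N : ℕ) : Lp ℂ p Hexagon.hexMeasure := (hmem b N).toLp _
  have hstep (b : ℕ) : ∃ K : ℝ, 0 ≤ K ∧ ∀ᶠ N : ℕ in atTop,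
      ‖x b (N + 1) - x b N‖ ≤ K * (u (N + 1) * 2 ^ ((N + 1) * b)) := by
    obtain ⟨K, hK0, hK⟩ := Hexagon.eLpNorm_dyadic_sub_le b hp hf hu0 humono hA'
    refine ⟨K, hK0, ((tendsto_add_atTop_nat 1).eventually hK).mono fun N hN => ?_⟩
    have := hu0 (N + 1)
    rw [← MemLp.toLp_sub, Lp.norm_toLp]
    exact ENNReal.toReal_le_of_le_ofReal (by positivity) hN
  obtain ⟨D₁, hD₁, hsum₁⟩ := hZ.sum_le
  obtain ⟨D₂, hD₂, hsum₂⟩ := hZn.sum_le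
  obtain ⟨K₁, hK₁, hx₁⟩ := hstep 0
  obtain ⟨K₂, hK₂, hx₂⟩ := hstep n
  simp only [mul_zero, pow_zero, mul_one] at hx₁
  obtain ⟨y, hy, hyx⟩ := Hexagon.exists_limit_of_tail_bound hK₁ hD₁ (fun k => hu0 (k + 1))
    ((tendsto_add_atTop_iff_nat 1).2 hm.tendsto_half_pow) hx₁
    (((tendsto_add_atTop_nat 1).eventually hsum₁).mono fun N hN M => by
      refine le_trans (le_of_eq (Finset.sum_congr rfl fun k _ => ?_)) (hN M)
      rw [show N + k + 1 + 1 = N + 1 + k + 1 by omega])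
  obtain ⟨B, hB, hgrow⟩ := Hexagon.exists_growth_bound (C := D₂) hK₂
    (fun k => mul_nonneg (hu0 (k + 1)) (by positivity)) hx₂
    (((tendsto_add_atTop_nat 1).eventually hsum₂).mono fun N hN => by
      refine le_trans ?_ hN
      rw [Finset.sum_range_succ']
      have := hu0 0
      simp only [hu, zero_mul, pow_zero, mul_one] at this ⊢
      linarith)
  have hyi : Integrable y Hexagon.hexMeasure := (Lp.memLp y).integrable hp
  refine ⟨y, Hexagon.isRadialDeriv_of_coeff (hf.integrable hp) hyi fun k hk => ?_, Lp.memLp y,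
    K₁ * (1 + D₁) + 2 ^ n * (B * D₂), ?_⟩
  -- The limit is the radial derivative because each multiplier of the means tends to 1 as ϱ → 1.
  · refine tendsto_nhds_unique (Hexagon.tendsto_coeff_of_tendsto_Lp hy k) ?_
    have hco (N : ℕ) : Hexagon.coeff (x 0 N) k = ((Hexagon.size k).descFactorial m : ℂ) *
        (Hexagon.tapCoeff r (1 - (1 / 2) ^ (N + 1)) (Hexagon.size k) : ℂ) * Hexagon.coeff f k := by
      rw [Hexagon.coeff_congr_ae (hmem 0 N).coeFn_toLp k,
        Hexagon.coeff_radialMul (Hexagon.shellSummable_dyadicMul r m 0 (by omega)) f hk]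
      simp [Hexagon.dyadicMul]
    simp only [hco]
    have ht := (Hexagon.tendsto_tapCoeff (hn.trans hnr) (Hexagon.size k)).comp
      ((Hexagon.tendsto_one_sub_half_pow.mono_right nhdsWithin_le_nhds).comp (tendsto_add_atTop_nat 1))
    have ht' := (Complex.continuous_ofReal.tendsto 1).comp ht
    simpa using (ht'.const_mul ((Hexagon.size k).descFactorial m : ℂ)).mul_const (Hexagon.coeff f k)
  · obtain ⟨N₀, hN₀⟩ := eventually_atTop.1 (hyx.and hgrow)
    have hsmall : ∀ᶠ δ : ℝ in 𝓝[>] 0, δ ∈ Set.Ioo 0 ((1 / 2 : ℝ) ^ N₀) :=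
      Ioo_mem_nhdsGT (by positivity)
    filter_upwards [hsmall] with δ hδ
    -- The dyadic scale satisfies 2^(-(N+1)) < δ ≤ 2^(-N): the lower bound gives u (N + 1) ≤ ω δ,
    -- the upper one δ · 2^(N+1) ≤ 2.
    obtain ⟨N, hN1, hN2⟩ := exists_nat_pow_near_of_lt_one hδ.1
      (hδ.2.le.trans (Hexagon.half_pow_mem N₀).2) (by norm_num : (0 : ℝ) < 1 / 2) (by norm_num)
    have hNN : N₀ ≤ N := by
      by_contra hlt
      have : (1 / 2 : ℝ) ^ N₀ ≤ (1 / 2) ^ (N + 1) :=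
        pow_le_pow_of_le_one (by norm_num) (by norm_num) (by omega)
      linarith [hδ.2]
    obtain ⟨hclose, hder⟩ := hN₀ N hNN
    have huδ : u (N + 1) ≤ ω δ :=
      hm.mono (by positivity) hN1.le (hδ.2.le.trans (Hexagon.half_pow_mem N₀).2)
    have hωδ : 0 ≤ ω δ := (hu0 _).trans huδ
    refine (iInf₂_le (Hexagon.radialMul (Hexagon.dyadicMul r m 0 (N + 1)) f) (Hexagon.radialMul (Hexagon.dyadicMul r m n (N + 1)) f)
      |>.trans (iInf_le _ ⟨Hexagon.isRadialDeriv_dyadicMul r m n (by omega) f, hmem n N⟩)).trans ?_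
    have h1 : eLpNorm (⇑y - Hexagon.radialMul (Hexagon.dyadicMul r m 0 (N + 1)) f) p Hexagon.hexMeasure ≤
        ENNReal.ofReal (K₁ * (1 + D₁) * ω δ) := by
      have he : eLpNorm (⇑y - Hexagon.radialMul (Hexagon.dyadicMul r m 0 (N + 1)) f) p Hexagon.hexMeasure =
          ENNReal.ofReal ‖y - x 0 N‖ := by
        rw [ofReal_norm, Lp.enorm_def]
        exact eLpNorm_congr_ae (((EventuallyEq.refl _ (y : (Fin 3 → ℝ) → ℂ)).sub
          (hmem 0 N).coeFn_toLp.symm).trans (Lp.coeFn_sub y (x 0 N)).symm)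
      rw [he]
      refine ENNReal.ofReal_le_ofReal (hclose.trans ?_)
      gcongr
    have h2 : eLpNorm (Hexagon.radialMul (Hexagon.dyadicMul r m n (N + 1)) f) p Hexagon.hexMeasure ≤
        ENNReal.ofReal (B * (D₂ * (u (N + 1) * 2 ^ ((N + 1) * n)))) := by
      have he : eLpNorm (Hexagon.radialMul (Hexagon.dyadicMul r m n (N + 1)) f) p Hexagon.hexMeasure =
          ENNReal.ofReal ‖x n N‖ := by
        rw [Lp.norm_toLp, ENNReal.ofReal_toReal (hmem n N).eLpNorm_ne_top]
      rw [he]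
      exact ENNReal.ofReal_le_ofReal hder
    rw [add_mul, ENNReal.ofReal_add (by positivity) (by positivity)]
    refine add_le_add h1 ((mul_le_mul_right h2 _).trans ?_)
    rw [← ENNReal.ofReal_mul (pow_nonneg hδ.1.le n)]
    refine ENNReal.ofReal_le_ofReal ?_
    have hδ2 : δ * 2 ^ (N + 1) ≤ 2 := by
      calc δ * 2 ^ (N + 1) ≤ (1 / 2) ^ N * 2 ^ (N + 1) := by gcongr
        _ = 2 * (1 / 2 * 2) ^ N := by rw [mul_pow]; ring
        _ = 2 := by norm_num
    calc δ ^ n * (B * (D₂ * (u (N + 1) * 2 ^ ((N + 1) * n))))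
        = (δ * 2 ^ (N + 1)) ^ n * (B * D₂) * u (N + 1) := by
          rw [mul_pow, ← pow_mul]; ring
      _ ≤ 2 ^ n * (B * D₂) * ω δ := by
          have := hδ.1
          have := hu0 (N + 1)
          gcongr
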